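/- Let $K$ be a Markov transition kernel on $[0,\infty)$ and $G$ a probability distribution on $[0,\infty)$ such that $K\in D(G)$, i.e. $K(t,t\,\cdot)\Rightarrow G$ weakly on $[0,\infty]$ as $t\to\infty$. Let $\mathbf X=(X_0,X_1,\dots)$ be a homogeneous Markov chain on $[0,\infty)$ with transition kernel $K$ and $X_0\sim H$, where $H$ has a regularly varying tail: for some $\alpha>0$ and some scaling function $b(t)\to\infty$, $$t\,H(b(t)\,\cdot)\xrightarrow{v}\nu_\alpha\quad\text{in } M_+(0,\infty]\quad(t\to\infty),\qquad \nu_\alpha(x,\infty]=x^{-\alpha}.$$ Here $M_+(E)$ denotes the non-negative Radon measures on $E$, and $\xrightarrow{v}$ is vague convergence (convergence of the integrals of all non-negative continuous functions with compact support in $E$). An *extremal boundary* for $K$ is a function $y(t)\ge 0$ on $[0,\infty)$ with $y(t)\to0$ and $K(t,t[0,y(t)])\to G(\{0\})$ as $t\to\infty$; it is *uniform* if moreover $K(tu_t,t[0,y(t)])\to G(\{0\})$ for every non-negative function $u_t\to u>0$. Given a uniform extremal boundary $y$, put $\tau(t)=\inf\{n\ge0: X_n\le t\,y(t)\}$ (with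 $\inf\emptyset=\infty$) and let $X^{(t)}_n=X_n\mathbf 1\{n<\tau(t)\}$ be the extremal component of $\mathbf X$ relative to $t$. The kernel $K$ satisfies the *regularity condition* if $K(tu_t,t\,\cdot)\Rightarrow\delta_0$ weakly on $[0,\infty]$ for every non-negative function $u_t\to0$. Let $\mathbf T^*$ be the Markov chain on $[0,\infty)$ with kernel $K^*(y,A)=G(y^{-1}A)$ for $y>0$ and $K^*(0,\cdot)=\delta_0$, and define on $E_m=(0,\infty]\times[0,\infty]^m$ the measure $$\nu^*(dx_0,d\mathbf x_m)=\nu_\alpha(dx_0)\,P_{x_0}\big[(T_1^*,\dots,T_m^*)\in d\mathbf x_m\big].$$ Then for every $m\ge1$ the following hold as $t\to\infty$. (a) In $M_+((0,\infty]^m\times[0,\infty])$, $$t\,P\big[b(t)^{-1}(X_0,\dots,X_m)\in\cdot\,\cap(0,\infty]^m\times[0,\infty]\big]\xrightarrow{v}\nu^*\big(\cdot\,\cap(0,\infty]^m\times[0,\infty]\big).$$ (b) For every uniform extremal boundary $y$, in $M_+(E_m)$, $$t\,P\big[b(t)^{-1}(X_0^{(b(t))},\dots,X_m^{(b(t))})\in\cdot\,\big]\xrightarrow{v}\nu^*(\cdot).$$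 (c) If $G(\{0\})=0$, or $y\equiv0$ is an extremal boundary for $K$, or $K$ satisfies the regularity condition, then in $M_+(E_m)$, $$t\,P\big[b(t)^{-1}(X_0,\dots,X_m)\in\cdot\,\big]\xrightarrow{v}\nu^*(\cdot).$$ (d) For every uniform extremal boundary $y$, in $M_+(0,\infty]$, $$t\,P\big[X_0/b(t)\in\cdot\,,\ \tau(b(t))\ge m\big]\xrightarrow{v}(1-G(\{0\}))^{m-1}\,\nu_\alpha(\cdot).$$ -/

import Mathlib

open MeasureTheory ProbabilityTheory Filter Topology Set
open scoped NNReal ENNReal CompactlySupported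

noncomputable section

namespace TailChain

/-! The state space `[0,∞)` is `ℝ≥0`, its compactification `[0,∞]` is `ℝ≥0∞`, and "as `t → ∞`"
is the filter `atTop` on `ℝ≥0`. -/

/-- Vague convergence in `M₊(E)`, the space of non-negative Radon measures on `E` (for a locally
compact `E` with countable base these are the Borel measures that are finite on compact sets):
convergence of the integrals of all non-negative continuous functions with compact support. -/
structure VagueTendsto {E ι : Type*} [TopologicalSpace E] [MeasurableSpace E]
    (l : Filter ι) (μ : ι → Measure E) (ν : Measure E) : Prop where
  radon : ∀ᶠ i in l, IsFiniteMeasureOnCompacts (μ i)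
  radon_limit : IsFiniteMeasureOnCompacts ν
  tendsto : ∀ f : C_c(E, ℝ≥0),
    Tendsto (fun i => ∫⁻ x, (f x : ℝ≥0∞) ∂(μ i)) l (𝓝 (∫⁻ x, (f x : ℝ≥0∞) ∂ν))

/-- Vague convergence in `M₊(S)` of the restrictions `μ i (· ∩ S)` to `ν (· ∩ S)`, where `S` is a
measurable subset of the ambient space, with the subspace topology. -/
def VagueTendstoOn {E ι : Type*} [TopologicalSpace E] [MeasurableSpace E] (S : Set E)
    (l : Filter ι) (μ : ι → Measure E) (ν : Measure E) : Prop :=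
  VagueTendsto l (fun i => (μ i).comap (Subtype.val : S → E)) (ν.comap (Subtype.val : S → E))

/-- The cone `(0,∞]`. -/
def posCone : Set ℝ≥0∞ := {x | 0 < x}

/-- The cone `E_m = (0,∞] × [0,∞]^m` in `[0,∞]^{m+1}`. -/
def coneE (m : ℕ) : Set (Fin (m + 1) → ℝ≥0∞) := {x | 0 < x 0}

/-- The cone `(0,∞]^m × [0,∞]` in `[0,∞]^{m+1}`. -/
def coneRestr (m : ℕ) : Set (Fin (m + 1) → ℝ≥0∞) := {x | ∀ i : Fin m, 0 < x i.castSucc}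

lemma measurable_scale (s : ℝ≥0) : Measurable fun x : ℝ≥0 => ((x / s : ℝ≥0) : ℝ≥0∞) :=
  measurable_coe_nnreal_ennreal.comp (measurable_id.div_const s)

/-- The probability measure `A ↦ μ (s A)` on `[0,∞]` (for `s > 0`), i.e. the law of `x / s` when
`x` has law `μ`. -/
def scaledLaw (μ : Measure ℝ≥0) [IsProbabilityMeasure μ] (s : ℝ≥0) : ProbabilityMeasure ℝ≥0∞ :=
  ⟨μ.map fun x => ((x / s : ℝ≥0) : ℝ≥0∞),
    Measure.isProbabilityMeasure_map (measurable_scale s).aemeasurable⟩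

/-- `K ∈ D(G)`: `K(t, t ·) ⇒ G` weakly on `[0,∞]` as `t → ∞`. -/
def InDomainOfAttraction (K : Kernel ℝ≥0 ℝ≥0) [IsMarkovKernel K]
    (G : Measure ℝ≥0) [IsProbabilityMeasure G] : Prop :=
  Tendsto (fun t : ℝ≥0 => scaledLaw (K t) t) atTop (𝓝 (scaledLaw G 1))

/-- The regularity condition: `K(t u(t), t ·) ⇒ ε₀` weakly on `[0,∞]` for every non-negative
function `u(t) → 0`. -/
def RegularityCondition (K : Kernel ℝ≥0 ℝ≥0) [IsMarkovKernel K] : Prop :=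
  ∀ u : ℝ≥0 → ℝ≥0, Tendsto u atTop (𝓝 0) →
    Tendsto (fun t : ℝ≥0 => scaledLaw (K (t * u t)) t) atTop
      (𝓝 (scaledLaw (Measure.dirac 0) 1))

/-- `y` is an extremal boundary for `K ∈ D(G)`: a non-negative function with `y(t) → 0` and
`K(t, t [0, y(t)]) → G({0})`. -/
structure IsExtremalBoundary (K : Kernel ℝ≥0 ℝ≥0) (G : Measure ℝ≥0) (y : ℝ≥0 → ℝ≥0) : Prop where
  tendsto_zero : Tendsto y atTop (𝓝 0)
  tendsto_kernel : Tendsto (fun t : ℝ≥0 => K t (Iic (t * y t))) atTop (𝓝 (G {0}))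

/-- `y` is a uniform extremal boundary: moreover `K(t u(t), t [0, y(t)]) → G({0})` for every
non-negative function `u(t) → c > 0`. -/
structure IsUniformExtremalBoundary (K : Kernel ℝ≥0 ℝ≥0) (G : Measure ℝ≥0) (y : ℝ≥0 → ℝ≥0) : Prop
    extends IsExtremalBoundary K G y where
  uniform : ∀ (u : ℝ≥0 → ℝ≥0) (c : ℝ≥0), 0 < c → Tendsto u atTop (𝓝 c) →
    Tendsto (fun t : ℝ≥0 => K (t * u t) (Iic (t * y t))) atTop (𝓝 (G {0}))

/-- The tail kernel associated with `G`, with boundary distribution `B`: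
`K*(y, A) = G(y⁻¹ A) = G {z | y z ∈ A}` for `y > 0` and `K*(0, A) = B(A)`. -/
def tailKernel (G B : Measure ℝ≥0) [IsProbabilityMeasure G] : Kernel ℝ≥0 ℝ≥0 where
  toFun y := if y = 0 then B else G.map fun z => y * z
  measurable' := by
    refine Measurable.ite (measurableSet_singleton 0) measurable_const ?_
    refine Measure.measurable_of_measurable_coe _ fun s hs => ?_
    have h : ∀ y : ℝ≥0, (G.map fun z => y * z) s
        = G (Prod.mk y ⁻¹' ((fun p : ℝ≥0 × ℝ≥0 => p.1 * p.2) ⁻¹' s)) := fun y => by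
      rw [Measure.map_apply (measurable_const_mul y) hs]
      rfl
    simp_rw [h]
    exact measurable_measure_prodMk_left ((measurable_fst.mul measurable_snd) hs)

instance (G B : Measure ℝ≥0) [IsProbabilityMeasure G] [IsProbabilityMeasure B] :
    IsMarkovKernel (tailKernel G B) where
  isProbabilityMeasure y := by
    change IsProbabilityMeasure (if y = 0 then B else G.map fun z => y * z)
    split_ifs
    · infer_instance
    · exact Measure.isProbabilityMeasure_map (measurable_const_mul y).aemeasurable

lemma measurable_cons {E : Type*} [MeasurableSpace E] (m : ℕ) :
    Measurable fun p : E × (Fin m → E) => (Fin.cons p.1 p.2 : Fin (m + 1) → E) := by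
  refine measurable_pi_lambda _ fun i => ?_
  refine Fin.cases ?_ (fun j => ?_) i
  · simpa using measurable_fst
  · simp only [Fin.cons_succ]
    exact (measurable_pi_apply j).comp measurable_snd

/-- The law `P_x[(X_1, …, X_m) ∈ ·] = K(x, dx_1) K(x_1, dx_2) ⋯ K(x_{m-1}, dx_m)` of the first `m`
steps of a Markov chain with transition kernel `K` started at `x`. -/
def pathKernel (K : Kernel ℝ≥0 ℝ≥0) : (m : ℕ) → Kernel ℝ≥0 (Fin m → ℝ≥0)
  | 0 => Kernel.const _ (Measure.dirac Fin.elim0)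
  | m + 1 => (K ⊗ₖ (pathKernel K m).comap Prod.snd measurable_snd).map
      fun p => (Fin.cons p.1 p.2 : Fin (m + 1) → ℝ≥0)

instance (K : Kernel ℝ≥0 ℝ≥0) [IsMarkovKernel K] (m : ℕ) : IsMarkovKernel (pathKernel K m) := by
  induction m with
  | zero => unfold pathKernel; infer_instance
  | succ m ih => unfold pathKernel; exact Kernel.IsMarkovKernel.map _ (measurable_cons m)

/-- The measure `ν_α` on `(0,∞)`, with density `α x^{-α-1}`, so that `ν_α(x,∞) = x^{-α}`. -/
def nuAlpha (α : ℝ) : Measure ℝ≥0 :=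
  (((volume : Measure ℝ).restrict (Ioi 0)).withDensity
    fun x => ENNReal.ofReal (α * x ^ (-α - 1))).map Real.toNNReal

lemma nuAlpha_Ioi {α : ℝ} (hα : 0 < α) {x : ℝ≥0} (hx : 0 < x) :
    nuAlpha α (Ioi x) = ENNReal.ofReal ((x : ℝ) ^ (-α)) := by
  have hx' : (0 : ℝ) < x := hx
  have hpre : Real.toNNReal ⁻¹' Ioi x = Ioi (x : ℝ) := by
    ext z
    simp [Real.lt_toNNReal_iff_coe_lt]
  rw [nuAlpha, Measure.map_apply measurable_real_toNNReal measurableSet_Ioi, hpre,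
    withDensity_apply _ measurableSet_Ioi, Measure.restrict_restrict measurableSet_Ioi,
    inter_eq_left.2 (Ioi_subset_Ioi hx'.le),
    ← ofReal_integral_eq_lintegral_ofReal
      ((integrableOn_Ioi_rpow_of_lt (by linarith) hx').const_mul α),
    integral_const_mul, integral_Ioi_rpow_of_lt (by linarith) hx']
  · congr 1
    have : -α - 1 + 1 = -α := by ring
    rw [this]
    field_simp
  · filter_upwards [ae_restrict_mem measurableSet_Ioi] with z hz
    have : (0 : ℝ) < z := hx'.trans hz
    positivity

/-- `ν_α` as a measure on `(0,∞]` (regarded inside `[0,∞]`): no mass at `0` or `∞`. -/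
def nuAlphaE (α : ℝ) : Measure ℝ≥0∞ := (nuAlpha α).map (↑)

instance (α : ℝ) : SFinite (nuAlpha α) := by
  unfold nuAlpha
  infer_instance

/-- The measure `ν*(dx_0, dx) = ν_α(dx_0) P_{x_0}[(T*_1, …, T*_m) ∈ dx]` on `(0,∞] × [0,∞]^m`
(regarded inside `[0,∞]^{m+1}`), where `T*` is the tail chain associated with `(G, ε₀)`. -/
def nuStar (G : Measure ℝ≥0) [IsProbabilityMeasure G] (α : ℝ) (m : ℕ) :
    Measure (Fin (m + 1) → ℝ≥0∞) :=
  (nuAlpha α ⊗ₘ pathKernel (tailKernel G (Measure.dirac 0)) m).map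
    fun p i => ((Fin.cons p.1 p.2 : Fin (m + 1) → ℝ≥0) i : ℝ≥0∞)

section Chain

variable {Ω : Type*}

/-- `X` is a homogeneous Markov chain with transition kernel `K`: the conditional law of `X_{n+1}`
given `(X_0, …, X_n)` is `K(X_n, ·)`, i.e. the law of `((X_0, …, X_n), X_{n+1})` is
`P[(X_0, …, X_n) ∈ dx] K(x_n, dx')`. -/
structure IsMarkovChain [MeasurableSpace Ω] (X : ℕ → Ω → ℝ≥0) (K : Kernel ℝ≥0 ℝ≥0)
    (P : Measure Ω) : Prop where
  measurable : ∀ n, Measurable (X n)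
  step : ∀ n : ℕ,
    P.map (fun ω => ((fun i : Fin (n + 1) => X i ω), X (n + 1) ω))
      = P.map (fun ω (i : Fin (n + 1)) => X i ω) ⊗ₘ
          K.comap (fun x : Fin (n + 1) → ℝ≥0 => x (Fin.last n)) (measurable_pi_apply _)

/-- `τ(t) = inf {n ≥ 0 : X_n ≤ t y(t)}`, with `inf ∅ = ∞`. -/
def tau (X : ℕ → Ω → ℝ≥0) (y : ℝ≥0 → ℝ≥0) (t : ℝ≥0) (ω : Ω) : ℕ∞ :=
  ⨅ (n : ℕ) (_ : X n ω ≤ t * y t), (n : ℕ∞)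

open Classical in
/-- The extremal component of `X` relative to `t`: `X_n^{(t)} = X_n 1{n < τ(t)}`. -/
def extremalComponent (X : ℕ → Ω → ℝ≥0) (y : ℝ≥0 → ℝ≥0) (t : ℝ≥0) (n : ℕ) (ω : Ω) : ℝ≥0 :=
  if (n : ℕ∞) < tau X y t ω then X n ω else 0

/-- The law `P[s⁻¹ (X_0, …, X_m) ∈ ·]` on `[0,∞]^{m+1}`. -/
def scaledFdd [MeasurableSpace Ω] (P : Measure Ω) (X : ℕ → Ω → ℝ≥0) (m : ℕ) (s : ℝ≥0) :
    Measure (Fin (m + 1) → ℝ≥0∞) :=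
  P.map fun ω i => ((X i ω / s : ℝ≥0) : ℝ≥0∞)

end Chain

end TailChain

end

noncomputable section

namespace TailChain

/-! ### Fatou's lemma and continuous mapping for varying measures -/

section ContinuousMapping

/-! Measured in units of `s = b t`, the chain has initial measure `t H(s ·)`, which tends vaguely to
`ν_α`, and transition kernel `K_s = scaledKernel K s`. For `x` near `x₀ > 0`, `K_s(x, ·)` is the law
`K(u, u ·)` at `u = s x`, multiplied by `x`. Since `u → ∞`, attraction to `G` makes it converge,
continuously in `x`, to the tail kernel at `x₀`. An induction on the number of steps passes this to
path expectations (`tendsto_pathExpect`). After one step the remaining test function depends on the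
point reached, so convergence is proved jointly in the scale, the starting point and the test
function. The analytic tool is a continuous mapping theorem for varying measures and integrands
(`tendsto_lintegral_of_isNhdsSystem`), and a last integration over the initial law gives
`tendsto_lintegral_pathExpectCons`.

The obstacle is the state `0`: the tail chain is absorbed there, while attraction says nothing about
`K_s(x, ·)` for `x` near `0`. For (a) the test functions vanish when a non-final point is small. For
(b) and (d) the chain is killed below the boundary, so `0` is absorbing. Giving `0` the
neighbourhood filter `pure 0` makes it an isolated point, and uniformity of the boundary says
precisely that the mass there converges to `G {0}`. The first two cases of (c) also isolate `0`; the
third has continuous convergence at `0` from the regularity condition. To treat all cases at once,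
neighbourhoods are abstracted to `nhdsWithZero Z`, and kernels enter only through the lower bound
`TailLimit`.

For (d), each step from a positive state survives with limiting probability `1 - G {0}`, whatever
that state is (`tendsto_lintegral_aliveLast`). -/

theorem lintegral_eq_lintegral_meas_ofReal_lt {X : Type*} [MeasurableSpace X] (μ : Measure X)
    {f : X → ℝ≥0∞} (hf : Measurable f) (hfin : ∀ x, f x ≠ ∞) :
    ∫⁻ x, f x ∂μ = ∫⁻ r in Ioi (0 : ℝ), μ {x | ENNReal.ofReal r < f x} := by
  have h1 : ∫⁻ x, f x ∂μ = ∫⁻ x, ENNReal.ofReal (f x).toReal ∂μ :=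
    lintegral_congr fun x => (ENNReal.ofReal_toReal (hfin x)).symm
  rw [h1, lintegral_eq_lintegral_meas_lt μ (Eventually.of_forall fun x => ENNReal.toReal_nonneg)
    hf.ennreal_toReal.aemeasurable]
  refine setLIntegral_congr_fun measurableSet_Ioi fun r hr => ?_
  congr 1
  ext x
  simp only [mem_ofPred_eq]
  rw [ENNReal.ofReal_lt_iff_lt_toReal (le_of_lt hr) (hfin x)]

/-- A system of filters `N x` with the properties of a system of neighbourhood filters. -/
structure IsNhdsSystem {X : Type*} (N : X → Filter X) : Prop where
  pure_le : ∀ x, pure x ≤ N x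
  isOpen : ∀ x, ∀ A ∈ N x, {z | A ∈ N z} ∈ N x

variable {X ι : Type*} [MeasurableSpace X] {N : X → Filter X} {l : Filter ι}

/-- Fatou's lemma for a varying measure: if the measures satisfy the portmanteau lower bound on
open sets and the integrands are jointly lower semicontinuous in the limit, then the integral of
the limit is at most the lower limit of the integrals. -/
theorem lintegral_le_liminf_lintegral_of_isNhdsSystem [l.IsCountablyGenerated]
    (hN : IsNhdsSystem N) {μ : ι → Measure X} {μ₀ : Measure X}
    (hμ : ∀ U : Set X, (∀ x ∈ U, U ∈ N x) → μ₀ U ≤ liminf (fun i => μ i U) l)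
    {f : ι → X → ℝ≥0∞} {f₀ : X → ℝ≥0∞} (hf : ∀ i, Measurable (f i)) (hf₀ : Measurable f₀)
    (hfin : ∀ i x, f i x ≠ ∞) (hfin₀ : ∀ x, f₀ x ≠ ∞)
    (hlim : ∀ᵐ x ∂μ₀, ∀ r < f₀ x, ∀ᶠ p in l ×ˢ N x, r < f p.1 p.2) :
    ∫⁻ x, f₀ x ∂μ₀ ≤ liminf (fun i => ∫⁻ x, f i x ∂(μ i)) l := by
  have key : ∀ r : ℝ≥0∞, μ₀ {x | r < f₀ x} ≤ liminf (fun i => μ i {x | r < f i x}) l := by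
    intro r
    obtain ⟨B, hB⟩ := l.exists_antitone_basis
    -- `U n` is the interior of `A n` for the system `N`. The joint limit condition puts almost
    -- every point of `{r < f₀}` in some `U n`, so an increasing union reduces the claim to the
    -- bound on open sets.
    set A : ℕ → Set X := fun n => {x | ∀ i ∈ B n, r < f i x} with hA
    set U : ℕ → Set X := fun n => {x | A n ∈ N x} with hU
    have hAm : Monotone A := fun m n hmn x hx i hi => hx i (hB.antitone hmn hi)
    have hUm : Monotone U := fun m n hmn x hx => mem_of_superset hx (hAm hmn)
    have hsub : {x | r < f₀ x} ≤ᵐ[μ₀] ⋃ n, U n := by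
      filter_upwards [hlim] with x hlim hx
      obtain ⟨S, hS, T, hT, hST⟩ := mem_prod_iff.1 (hlim r hx)
      obtain ⟨n, -, hn⟩ := hB.1.mem_iff.1 hS
      refine mem_iUnion.2 ⟨n, mem_of_superset hT fun z hz i hi => ?_⟩
      exact hST (show (i, z) ∈ S ×ˢ T from ⟨hn hi, hz⟩)
    have hUA : ∀ n, U n ⊆ A n := fun n x hx => hN.pure_le x hx
    calc μ₀ {x | r < f₀ x} ≤ μ₀ (⋃ n, U n) := measure_mono_ae hsub
      _ = ⨆ n, μ₀ (U n) := hUm.measure_iUnion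
      _ ≤ liminf (fun i => μ i {x | r < f i x}) l := by
        refine iSup_le fun n => (hμ (U n) fun x hx => hN.isOpen x _ hx).trans ?_
        refine liminf_le_liminf ?_
        filter_upwards [hB.1.mem_of_mem (i := n) trivial] with i hi
        exact measure_mono fun x hx => hUA n hx i hi
  rw [lintegral_eq_lintegral_meas_ofReal_lt μ₀ hf₀ hfin₀]
  simp_rw [fun i => lintegral_eq_lintegral_meas_ofReal_lt (μ i) (hf i) (hfin i)]
  -- The layers are combined by the ordinary Fatou lemma in the level `r`.
  refine (lintegral_mono fun r => key (ENNReal.ofReal r)).trans ?_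
  refine lintegral_liminf_le fun i => Antitone.measurable fun r s hrs => ?_
  exact measure_mono fun x hx => lt_of_le_of_lt (ENNReal.ofReal_le_ofReal hrs) hx

/-- Extended continuous mapping theorem, with a converging dominating family. -/
theorem tendsto_lintegral_of_isNhdsSystem [l.IsCountablyGenerated]
    (hN : IsNhdsSystem N) {μ : ι → Measure X} {μ₀ : Measure X}
    (hμ : ∀ U : Set X, (∀ x ∈ U, U ∈ N x) → μ₀ U ≤ liminf (fun i => μ i U) l)
    {f : ι → X → ℝ≥0∞} {f₀ h : X → ℝ≥0∞} (hf : ∀ i, Measurable (f i)) (hf₀ : Measurable f₀)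
    (hh : Measurable h) (hfh : ∀ᶠ i in l, ∀ x, f i x ≤ h x) (hfh₀ : ∀ x, f₀ x ≤ h x)
    (hfin : ∀ x, h x ≠ ∞) (hcont : ∀ x, Tendsto h (N x) (𝓝 (h x)))
    (hint : Tendsto (fun i => ∫⁻ x, h x ∂(μ i)) l (𝓝 (∫⁻ x, h x ∂μ₀)))
    (hint₀ : ∫⁻ x, h x ∂μ₀ ≠ ∞)
    (hlim : ∀ᵐ x ∂μ₀, Tendsto (fun p : ι × X => f p.1 p.2) (l ×ˢ N x) (𝓝 (f₀ x))) :
    Tendsto (fun i => ∫⁻ x, f i x ∂(μ i)) l (𝓝 (∫⁻ x, f₀ x ∂μ₀)) := by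
  rcases l.eq_or_neBot with rfl | hl
  · exact tendsto_bot
  -- Domination holds only eventually; truncating at `h` makes it hold for every index without
  -- changing the limit.
  set f' : ι → X → ℝ≥0∞ := fun i x => min (f i x) (h x) with hf'
  have hm : ∀ i, Measurable (f' i) := fun i => (hf i).min hh
  have hff' : (fun i => ∫⁻ x, f' i x ∂(μ i)) =ᶠ[l] fun i => ∫⁻ x, f i x ∂(μ i) := by
    filter_upwards [hfh] with i hi
    exact lintegral_congr fun x => min_eq_left (hi x)
  have hlim' : ∀ᵐ x ∂μ₀, Tendsto (fun p : ι × X => f' p.1 p.2) (l ×ˢ N x) (𝓝 (f₀ x)) := by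
    filter_upwards [hlim] with x hx
    have := hx.min ((hcont x).comp tendsto_snd)
    rwa [min_eq_left (hfh₀ x)] at this
  have hle : ∀ i x, f' i x ≤ h x := fun i x => min_le_right _ _
  have hfin' : ∀ i x, f' i x ≠ ∞ := fun i x => ne_top_of_le_ne_top (hfin x) (hle i x)
  have hfin₀ : ∀ x, f₀ x ≠ ∞ := fun x => ne_top_of_le_ne_top (hfin x) (hfh₀ x)
  refine Tendsto.congr' hff' ?_
  have lower := lintegral_le_liminf_lintegral_of_isNhdsSystem hN hμ hm hf₀ hfin' hfin₀
    (hlim'.mono fun x hx r hr => hx.eventually (lt_mem_nhds hr))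
  -- The upper bound is Fatou's lemma for `h - f'`, using that the integrals of `h` converge to a
  -- finite limit.
  have upper := lintegral_le_liminf_lintegral_of_isNhdsSystem (f := fun i x => h x - f' i x)
    (f₀ := fun x => h x - f₀ x) hN hμ (fun i => hh.sub (hm i)) (hh.sub hf₀)
    (fun i x => ne_top_of_le_ne_top (hfin x) tsub_le_self)
    (fun x => ne_top_of_le_ne_top (hfin x) tsub_le_self)
    (hlim'.mono fun x hx r hr => (ENNReal.Tendsto.sub ((hcont x).comp tendsto_snd) hx
      (Or.inl (hfin x))).eventually (lt_mem_nhds hr))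
  have hfi₀ : ∫⁻ x, f₀ x ∂μ₀ ≠ ∞ := ne_top_of_le_ne_top hint₀ (lintegral_mono hfh₀)
  have hfi : ∀ᶠ i in l, ∫⁻ x, f' i x ∂(μ i) ≠ ∞ := by
    filter_upwards [hint.eventually (gt_mem_nhds hint₀.lt_top)] with i hi
    exact ne_top_of_le_ne_top hi.ne (lintegral_mono (hle i))
  rw [lintegral_sub hf₀ hfi₀ (Eventually.of_forall hfh₀)] at upper
  have upper' : ∫⁻ x, h x ∂μ₀ - ∫⁻ x, f₀ x ∂μ₀
      ≤ liminf (fun i => ∫⁻ x, h x ∂(μ i) - ∫⁻ x, f' i x ∂(μ i)) l := by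
    refine upper.trans_eq (liminf_congr ?_)
    filter_upwards [hfi] with i hi
    exact lintegral_sub (hm i) hi (Eventually.of_forall (hle i))
  refine tendsto_of_le_liminf_of_limsup_le lower ?_
  refine le_of_forall_gt_imp_ge_of_dense fun c hc => ?_
  refine limsup_le_of_le (by isBoundedDefault) ?_
  -- The second case needs some `r` strictly below the difference. When the difference is zero,
  -- domination by `h` alone suffices.
  rcases eq_or_ne (∫⁻ x, h x ∂μ₀ - ∫⁻ x, f₀ x ∂μ₀) 0 with h0 | h0
  · have : ∫⁻ x, h x ∂μ₀ < c := (tsub_eq_zero_iff_le.1 h0).trans_lt hc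
    filter_upwards [hint.eventually (gt_mem_nhds this)] with i hi
    exact (lintegral_mono (hle i)).trans hi.le
  · set d := ∫⁻ x, h x ∂μ₀ - ∫⁻ x, f₀ x ∂μ₀ with hd
    have hsub : ∫⁻ x, h x ∂μ₀ - d < c := by
      rwa [hd, ENNReal.sub_sub_cancel hint₀ (lintegral_mono hfh₀)]
    have hc1 : ∀ᶠ r in 𝓝[<] d, ∫⁻ x, h x ∂μ₀ - r < c :=
      (((ENNReal.continuous_sub_left hint₀).tendsto d).eventually (gt_mem_nhds hsub)).filter_mono
        nhdsWithin_le_nhds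
    have : (𝓝[<] d).NeBot := nhdsLT_neBot_of_exists_lt ⟨0, pos_iff_ne_zero.2 h0⟩
    obtain ⟨r, hrc, hrd⟩ := (hc1.and self_mem_nhdsWithin).exists
    have hrd' : r < d := hrd
    filter_upwards [eventually_lt_of_lt_liminf (hrd'.trans_le upper'), hfi,
      (ENNReal.Tendsto.sub hint tendsto_const_nhds (Or.inl hint₀)).eventually (gt_mem_nhds hrc),
      hint.eventually (gt_mem_nhds hint₀.lt_top)] with i hi1 hi2 hi3 hi4
    rw [← ENNReal.sub_sub_cancel hi4.ne (lintegral_mono (hle i))]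
    exact (tsub_le_tsub_left hi1.le _).trans hi3.le

/-- The neighbourhood filters of `ℝ≥0`, with those of `0` replaced by `Z`. -/
def nhdsWithZero (Z : Filter ℝ≥0) (x : ℝ≥0) : Filter ℝ≥0 := if x = 0 then Z else 𝓝 x

theorem nhdsWithZero_zero (Z : Filter ℝ≥0) : nhdsWithZero Z 0 = Z := if_pos rfl

theorem nhdsWithZero_of_pos (Z : Filter ℝ≥0) {x : ℝ≥0} (hx : 0 < x) : nhdsWithZero Z x = 𝓝 x :=
  if_neg hx.ne'

theorem nhdsWithZero_nhds : nhdsWithZero (𝓝 0) = 𝓝 := by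
  funext x
  unfold nhdsWithZero
  split_ifs with h
  · rw [h]
  · rfl

theorem isNhdsSystem_nhds : IsNhdsSystem (𝓝 : ℝ≥0 → Filter ℝ≥0) where
  pure_le := pure_le_nhds
  isOpen _ _ hA := eventually_mem_nhds_iff.2 hA

/-- This is the topology of the disjoint union of `{0}` and `(0,∞)`. -/
theorem isNhdsSystem_nhdsWithZero_pure : IsNhdsSystem (nhdsWithZero (pure 0)) where
  pure_le x := by
    unfold nhdsWithZero
    split_ifs with h
    · rw [h]
    · exact pure_le_nhds x
  isOpen x A hA := by
    rcases eq_or_ne x 0 with rfl | hx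
    · rw [nhdsWithZero_zero] at hA ⊢
      exact mem_pure.2 (by simpa [nhdsWithZero_zero] using hA)
    · have hx' := pos_iff_ne_zero.2 hx
      rw [nhdsWithZero_of_pos _ hx'] at hA ⊢
      filter_upwards [eventually_mem_nhds_iff.2 hA, lt_mem_nhds hx'] with z hz hz0
      rwa [nhdsWithZero_of_pos _ hz0]

/-- Convergence along all functions `u` tending to `c` is continuous convergence at `c`. -/
theorem tendsto_of_forall_comp_tendsto {E : Type*} [TopologicalSpace E]
    {F : ℝ≥0 → ℝ≥0 → E} {c : ℝ≥0} {a : E}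
    (hF : ∀ u : ℝ≥0 → ℝ≥0, Tendsto u atTop (𝓝 c) → Tendsto (fun t => F t (u t)) atTop (𝓝 a)) :
    Tendsto (fun p : ℝ≥0 × ℝ≥0 => F p.1 p.2) (atTop ×ˢ 𝓝 c) (𝓝 a) := by
  classical
  intro V hV
  by_contra hcon
  have hcon' : ¬ ∀ᶠ p : ℝ≥0 × ℝ≥0 in atTop ×ˢ 𝓝 c, F p.1 p.2 ∈ V := hcon
  obtain ⟨p, hp, hpV⟩ := exists_seq_forall_of_frequently (not_eventually.1 hcon')
  rw [tendsto_prod_iff'] at hp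
  -- Thinning the counterexample to strictly increasing times makes the times distinct, so that one
  -- function `u` can pass through all of its points.
  obtain ⟨φ, hφ, hφm⟩ : ∃ φ : ℕ → ℕ, StrictMono φ ∧ StrictMono fun n => (p (φ n)).1 :=
    strictMono_subseq_of_tendsto_atTop hp.1
  set q := fun n => p (φ n) with hq
  set u : ℝ≥0 → ℝ≥0 := fun t => if h : ∃ n, (q n).1 = t then (q h.choose).2 else c with hu
  have hq1 : Tendsto (fun n => (q n).1) atTop atTop := hp.1.comp hφ.tendsto_atTop
  have hq2 : Tendsto (fun n => (q n).2) atTop (𝓝 c) := hp.2.comp hφ.tendsto_atTop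
  have huq : ∀ n, u (q n).1 = (q n).2 := fun n => by
    have h : ∃ k, (q k).1 = (q n).1 := ⟨n, rfl⟩
    rw [hu]
    simp only [dif_pos h]
    rw [hφm.injective h.choose_spec]
  have hut : Tendsto u atTop (𝓝 c) := by
    refine tendsto_def.2 fun W hW => ?_
    obtain ⟨n, hn⟩ := eventually_atTop.1 (hq2.eventually hW)
    filter_upwards [eventually_ge_atTop (q n).1] with t ht
    by_cases h : ∃ k, (q k).1 = t
    · obtain ⟨k, rfl⟩ := h
      rw [mem_preimage, huq]
      exact hn k (hφm.le_iff_le.1 ht)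
    · simp only [hu, mem_preimage, dif_neg h]
      exact mem_of_mem_nhds hW
  have hev := ((hF u hut).comp hq1).eventually hV
  obtain ⟨n, hn⟩ := hev.exists
  refine hpV (φ n) ?_
  rw [Function.comp_apply, huq] at hn
  exact hn

end ContinuousMapping

/-! ### Path laws, scaling and killing -/

section Paths

theorem measurable_cons_right {m : ℕ} (x : ℝ≥0) : Measurable fun w : Fin m → ℝ≥0 =>
    (Fin.cons x w : Fin (m + 1) → ℝ≥0) := (measurable_cons m).comp measurable_prodMk_left

theorem measurable_snoc {m : ℕ} : Measurable fun p : (Fin m → ℝ≥0) × ℝ≥0 =>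
    (Fin.snoc p.1 p.2 : Fin (m + 1) → ℝ≥0) := by
  refine measurable_pi_lambda _ fun i => ?_
  refine Fin.lastCases ?_ (fun j => ?_) i
  · simpa using measurable_snd
  · simp only [Fin.snoc_castSucc]
    exact (measurable_pi_apply j).comp measurable_fst

theorem lintegral_pathKernel_zero (K : Kernel ℝ≥0 ℝ≥0) (x : ℝ≥0) (F : (Fin 0 → ℝ≥0) → ℝ≥0∞) :
    ∫⁻ w, F w ∂pathKernel K 0 x = F Fin.elim0 := by
  simp [pathKernel, Kernel.const_apply, lintegral_dirac' _ (Subsingleton.measurable (f := F))]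

theorem lintegral_pathKernel_succ (K : Kernel ℝ≥0 ℝ≥0) [IsMarkovKernel K] (m : ℕ) (x : ℝ≥0)
    {F : (Fin (m + 1) → ℝ≥0) → ℝ≥0∞} (hF : Measurable F) :
    ∫⁻ w, F w ∂pathKernel K (m + 1) x
      = ∫⁻ z, ∫⁻ w, F (Fin.cons z w) ∂pathKernel K m z ∂K x := by
  rw [pathKernel, Kernel.lintegral_map _ (measurable_cons m) _ hF]
  exact Kernel.lintegral_compProd _ _ _ (hF.comp (measurable_cons m))

theorem measurable_lintegral_pathKernel (K : Kernel ℝ≥0 ℝ≥0) [IsMarkovKernel K] (m : ℕ)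
    {F : (Fin (m + 1) → ℝ≥0) → ℝ≥0∞} (hF : Measurable F) :
    Measurable fun x => ∫⁻ w, F (Fin.cons x w) ∂pathKernel K m x :=
  (hF.comp (measurable_cons m)).lintegral_kernel_prod_right' (κ := pathKernel K m)

theorem measurable_lintegral_snoc (K : Kernel ℝ≥0 ℝ≥0) [IsMarkovKernel K] (m : ℕ)
    {F : (Fin (m + 2) → ℝ≥0) → ℝ≥0∞} (hF : Measurable F) :
    Measurable fun w : Fin (m + 1) → ℝ≥0 => ∫⁻ z, F (Fin.snoc w z) ∂K (w (Fin.last m)) :=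
  (hF.comp measurable_snoc).lintegral_kernel_prod_right'
    (κ := K.comap (fun w : Fin (m + 1) → ℝ≥0 => w (Fin.last m)) (measurable_pi_apply _))

/-- `pathKernel` is built by prepending the first step, whereas `IsMarkovChain` describes the last
one. This identity reconciles the two. -/
theorem lintegral_pathKernel_snoc (K : Kernel ℝ≥0 ℝ≥0) [IsMarkovKernel K] (m : ℕ) (x : ℝ≥0)
    {F : (Fin (m + 2) → ℝ≥0) → ℝ≥0∞} (hF : Measurable F) :
    ∫⁻ w, F (Fin.cons x w) ∂pathKernel K (m + 1) x
      = ∫⁻ w, ∫⁻ z, F (Fin.snoc (Fin.cons x w : Fin (m + 1) → ℝ≥0) z)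
          ∂K ((Fin.cons x w : Fin (m + 1) → ℝ≥0) (Fin.last m)) ∂pathKernel K m x := by
  induction m generalizing x with
  | zero =>
    have hFx : Measurable fun w : Fin 1 → ℝ≥0 => F (Fin.cons x w) :=
      hF.comp (measurable_cons_right x)
    rw [lintegral_pathKernel_succ K 0 x hFx, lintegral_pathKernel_zero]
    refine lintegral_congr fun z => ?_
    rw [lintegral_pathKernel_zero]
    congr 1
    ext i
    fin_cases i <;> rfl
  | succ m ih =>
    have hFx : Measurable fun w : Fin (m + 2) → ℝ≥0 => F (Fin.cons x w) :=
      hF.comp (measurable_cons_right x)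
    rw [lintegral_pathKernel_succ K (m + 1) x hFx]
    refine Eq.trans ?_ (lintegral_pathKernel_succ K m x
      ((measurable_lintegral_snoc K (m + 1) hF).comp (measurable_cons_right x))).symm
    refine lintegral_congr fun z => ?_
    refine (ih z hFx).trans (lintegral_congr fun w => ?_)
    simp only [Function.comp_apply]
    rw [Fin.cons_last]
    refine lintegral_congr fun y => ?_
    rw [Fin.cons_snoc_eq_snoc_cons]

theorem IsMarkovChain.lintegral_eq {Ω : Type*} [MeasurableSpace Ω] {P : Measure Ω}
    [IsProbabilityMeasure P] {K : Kernel ℝ≥0 ℝ≥0} [IsMarkovKernel K] {X : ℕ → Ω → ℝ≥0}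
    (hX : IsMarkovChain X K P) (m : ℕ) {F : (Fin (m + 1) → ℝ≥0) → ℝ≥0∞} (hF : Measurable F) :
    ∫⁻ ω, F (fun i => X i ω) ∂P
      = ∫⁻ x, ∫⁻ w, F (Fin.cons x w) ∂pathKernel K m x ∂P.map (X 0) := by
  induction m with
  | zero =>
    rw [lintegral_map (measurable_lintegral_pathKernel K 0 hF) (hX.measurable 0)]
    refine lintegral_congr fun ω => ?_
    rw [lintegral_pathKernel_zero]
    congr 1
    ext i
    fin_cases i
    rfl
  | succ m ih =>
    have hm : Measurable fun ω (i : Fin (m + 1)) => X i ω :=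
      measurable_pi_lambda _ fun i => hX.measurable i
    have hFs : Measurable fun p : (Fin (m + 1) → ℝ≥0) × ℝ≥0 => F (Fin.snoc p.1 p.2) :=
      hF.comp measurable_snoc
    have h1 : ∫⁻ ω, F (fun i => X i ω) ∂P
        = ∫⁻ p, F (Fin.snoc p.1 p.2)
          ∂P.map (fun ω => ((fun i : Fin (m + 1) => X i ω), X (m + 1) ω)) := by
      rw [lintegral_map hFs (hm.prodMk (hX.measurable _))]
      refine lintegral_congr fun ω => ?_
      congr 1
      ext i
      refine Fin.lastCases ?_ (fun j => ?_) i <;> simp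
    rw [h1, hX.step, Measure.lintegral_compProd hFs]
    simp only [Kernel.comap_apply]
    rw [lintegral_map (measurable_lintegral_snoc K m hF) hm, ih (measurable_lintegral_snoc K m hF)]
    exact lintegral_congr fun x => (lintegral_pathKernel_snoc K m x hF).symm

/-- The kernel of the chain with kernel `K` in units of `s`. -/
def scaledKernel (K : Kernel ℝ≥0 ℝ≥0) (s : ℝ≥0) : Kernel ℝ≥0 ℝ≥0 :=
  (K.comap (fun x => s * x) (measurable_const_mul s)).map fun x => x / s

instance (K : Kernel ℝ≥0 ℝ≥0) [IsMarkovKernel K] (s : ℝ≥0) : IsMarkovKernel (scaledKernel K s) :=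
  Kernel.IsMarkovKernel.map _ (measurable_id.div_const s)

theorem lintegral_scaledKernel (K : Kernel ℝ≥0 ℝ≥0) (s x : ℝ≥0) {F : ℝ≥0 → ℝ≥0∞}
    (hF : Measurable F) : ∫⁻ z, F z ∂scaledKernel K s x = ∫⁻ z, F (z / s) ∂K (s * x) := by
  rw [scaledKernel, Kernel.lintegral_map _ (by fun_prop) _ hF, Kernel.comap_apply]

theorem measurable_path_div {m : ℕ} (s : ℝ≥0) :
    Measurable fun w : Fin m → ℝ≥0 => fun i => w i / s :=
  by fun_prop

theorem cons_div {m : ℕ} (z s : ℝ≥0) (w : Fin m → ℝ≥0) :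
    (fun i => (Fin.cons z w : Fin (m + 1) → ℝ≥0) i / s)
      = Fin.cons (z / s) fun i => w i / s := by
  ext i
  refine Fin.cases ?_ (fun j => ?_) i <;> simp

theorem lintegral_pathKernel_scaledKernel (K : Kernel ℝ≥0 ℝ≥0) [IsMarkovKernel K] {s : ℝ≥0}
    (hs : 0 < s) (m : ℕ) (x : ℝ≥0) {F : (Fin m → ℝ≥0) → ℝ≥0∞} (hF : Measurable F) :
    ∫⁻ w, F w ∂pathKernel (scaledKernel K s) m x
      = ∫⁻ w, F (fun i => w i / s) ∂pathKernel K m (s * x) := by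
  induction m generalizing x with
  | zero =>
    rw [lintegral_pathKernel_zero, lintegral_pathKernel_zero]
    congr 1
    exact Subsingleton.elim _ _
  | succ m ih =>
    have hFs : Measurable fun w : Fin (m + 1) → ℝ≥0 => F fun i => w i / s :=
      hF.comp (measurable_path_div s)
    rw [lintegral_pathKernel_succ _ m x hF, lintegral_pathKernel_succ K m _ hFs,
      lintegral_scaledKernel K s x (measurable_lintegral_pathKernel _ m hF)]
    refine lintegral_congr fun z => ?_
    refine (ih (z / s) (hF.comp (measurable_cons_right _))).trans ?_
    rw [mul_div_cancel₀ _ hs.ne']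
    refine lintegral_congr fun w => ?_
    simp only [Function.comp_apply]
    rw [cons_div]

/-- The chain with kernel `K`, set to `0` forever as soon as it does not exceed `c`. -/
def killedKernel (K : Kernel ℝ≥0 ℝ≥0) (c : ℝ≥0) : Kernel ℝ≥0 ℝ≥0 :=
  Kernel.piecewise (measurableSet_singleton (0 : ℝ≥0)) (Kernel.const _ (Measure.dirac 0))
    (K.map fun z => if z ≤ c then 0 else z)

theorem measurable_truncate (c : ℝ≥0) : Measurable fun z : ℝ≥0 => if z ≤ c then 0 else z :=
  Measurable.ite measurableSet_Iic measurable_const measurable_id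

instance (K : Kernel ℝ≥0 ℝ≥0) [IsMarkovKernel K] (c : ℝ≥0) : IsMarkovKernel (killedKernel K c) := by
  have := Kernel.IsMarkovKernel.map K (measurable_truncate c)
  unfold killedKernel
  infer_instance

theorem killedKernel_zero (K : Kernel ℝ≥0 ℝ≥0) (c : ℝ≥0) :
    killedKernel K c 0 = Measure.dirac 0 := by
  simp [killedKernel, Kernel.piecewise_apply]

theorem killedKernel_of_pos (K : Kernel ℝ≥0 ℝ≥0) (c : ℝ≥0) {x : ℝ≥0} (hx : 0 < x) :
    killedKernel K c x = (K x).map fun z => if z ≤ c then 0 else z := by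
  simp [killedKernel, Kernel.piecewise_apply, hx.ne', Kernel.map_apply _ (measurable_truncate c)]

theorem tailKernel_zero (G : Measure ℝ≥0) [IsProbabilityMeasure G] :
    tailKernel G (Measure.dirac 0) 0 = Measure.dirac 0 := if_pos rfl

theorem tailKernel_of_pos (G : Measure ℝ≥0) [IsProbabilityMeasure G] {x : ℝ≥0} (hx : 0 < x) :
    tailKernel G (Measure.dirac 0) x = G.map fun z => x * z := if_neg hx.ne'

theorem lintegral_pathKernel_of_absorbing {K : Kernel ℝ≥0 ℝ≥0} [IsMarkovKernel K]
    (hK : K 0 = Measure.dirac 0) (m : ℕ) {F : (Fin m → ℝ≥0) → ℝ≥0∞} (hF : Measurable F) :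
    ∫⁻ w, F w ∂pathKernel K m 0 = F 0 := by
  induction m with
  | zero =>
    rw [lintegral_pathKernel_zero]
    congr 1
    exact Subsingleton.elim _ _
  | succ m ih =>
    rw [lintegral_pathKernel_succ K m 0 hF, hK,
      lintegral_dirac' _ (measurable_lintegral_pathKernel K m hF)]
    refine (ih (hF.comp (measurable_cons_right 0))).trans ?_
    simp only [Function.comp_apply]
    congr 1
    ext i
    refine Fin.cases ?_ (fun j => ?_) i <;> simp

open Classical in
/-- The path `w`, set to `0` from its first entry into `[0, c]` on. -/
def killPath (c : ℝ≥0) {m : ℕ} (w : Fin m → ℝ≥0) (i : Fin m) : ℝ≥0 :=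
  if ∀ j ≤ i, c < w j then w i else 0

theorem measurable_killPath (c : ℝ≥0) (m : ℕ) :
    Measurable (killPath c : (Fin m → ℝ≥0) → Fin m → ℝ≥0) := by
  classical
  refine measurable_pi_lambda _ fun i => ?_
  refine Measurable.ite ?_ (measurable_pi_apply i) measurable_const
  simp only [ofPred_forall]
  exact MeasurableSet.iInter fun j => MeasurableSet.iInter fun _ =>
    measurableSet_lt measurable_const (measurable_pi_apply j)

theorem killPath_cons_of_lt {c : ℝ≥0} {m : ℕ} {z : ℝ≥0} (hz : c < z) (w : Fin m → ℝ≥0) :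
    killPath c (Fin.cons z w : Fin (m + 1) → ℝ≥0) = Fin.cons z (killPath c w) := by
  ext i
  refine Fin.cases ?_ (fun j => ?_) i
  · simp [killPath, hz]
  · simp [killPath, Fin.forall_fin_succ, hz]

theorem killPath_cons_of_le {c : ℝ≥0} {m : ℕ} {z : ℝ≥0} (hz : z ≤ c) (w : Fin m → ℝ≥0) :
    killPath c (Fin.cons z w : Fin (m + 1) → ℝ≥0) = 0 := by
  ext i
  simp [killPath, Fin.forall_fin_succ, hz.not_gt]

/-- A first step into `[0, s c]` leaves the zero path on both sides; any other first step reduces to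
the induction hypothesis. The start must be positive because the killed kernel is absorbed at `0`,
but it need not exceed `c`: only later points are killed. -/
theorem lintegral_pathKernel_killedKernel (K : Kernel ℝ≥0 ℝ≥0) [IsMarkovKernel K] {s : ℝ≥0}
    (hs : 0 < s) (c : ℝ≥0) (m : ℕ) {x : ℝ≥0} (hx : 0 < x) {F : (Fin m → ℝ≥0) → ℝ≥0∞}
    (hF : Measurable F) :
    ∫⁻ w, F w ∂pathKernel (killedKernel (scaledKernel K s) c) m x
      = ∫⁻ w, F (fun i => killPath (s * c) w i / s) ∂pathKernel K m (s * x) := by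
  induction m generalizing x with
  | zero =>
    rw [lintegral_pathKernel_zero, lintegral_pathKernel_zero]
    congr 1
    exact Subsingleton.elim _ _
  | succ m ih =>
    have hg := measurable_lintegral_pathKernel (killedKernel (scaledKernel K s) c) m hF
    have hFs : Measurable fun w : Fin (m + 1) → ℝ≥0 => F fun i => killPath (s * c) w i / s :=
      hF.comp ((measurable_path_div s).comp (measurable_killPath _ _))
    rw [lintegral_pathKernel_succ _ m x hF, lintegral_pathKernel_succ K m _ hFs,
      killedKernel_of_pos _ _ hx, lintegral_map hg (measurable_truncate c)]
    refine (lintegral_scaledKernel K s x (hg.comp (measurable_truncate c))).trans ?_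
    refine lintegral_congr fun z => ?_
    simp only [Function.comp_apply]
    rcases le_or_gt z (s * c) with hz | hz
    · have hz' : z / s ≤ c := by rwa [div_le_iff₀' hs]
      rw [if_pos hz', lintegral_pathKernel_of_absorbing (killedKernel_zero _ _) m
        (F := fun w => F (Fin.cons 0 w)) (hF.comp (measurable_cons_right 0))]
      simp only [killPath_cons_of_le hz, lintegral_const, measure_univ, mul_one]
      congr 1
      ext i
      refine Fin.cases ?_ (fun j => ?_) i <;> simp
    · have hz' : c < z / s := by rwa [lt_div_iff₀' hs]
      rw [if_neg hz'.not_ge]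
      refine (ih (bot_le.trans_lt hz') (hF.comp (measurable_cons_right _))).trans ?_
      rw [mul_div_cancel₀ _ hs.ne']
      refine lintegral_congr fun w => ?_
      simp only [Function.comp_apply]
      rw [killPath_cons_of_lt hz, cons_div]

end Paths

/-! ### Limits of the one-step kernels -/

section TailLimits

theorem scaledLaw_image_coe (μ : Measure ℝ≥0) [IsProbabilityMeasure μ] (s : ℝ≥0) {V : Set ℝ≥0}
    (hV : IsOpen V) :
    (scaledLaw μ s : Measure ℝ≥0∞) ((↑) '' V) = μ.map (fun x => x / s) V := by
  have hV' : MeasurableSet ((fun x : ℝ≥0 => (x : ℝ≥0∞)) '' V) :=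
    (ENNReal.isOpenEmbedding_coe.isOpenMap V hV).measurableSet
  change μ.map (fun x => ((x / s : ℝ≥0) : ℝ≥0∞)) _ = _
  rw [Measure.map_apply (measurable_scale s) hV',
    Measure.map_apply (by fun_prop) hV.measurableSet]
  congr 1
  ext x
  simp

theorem tendsto_mul_atTop_nhds {c : ℝ≥0} (hc : 0 < c) :
    Tendsto (fun p : ℝ≥0 × ℝ≥0 => p.1 * p.2) (atTop ×ˢ 𝓝 c) atTop :=
  tendsto_fst.atTop_mul_pos hc tendsto_snd

theorem map_mul_left_singleton_zero (G : Measure ℝ≥0) {x₀ : ℝ≥0} (hx₀ : 0 < x₀) :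
    G.map (fun z => x₀ * z) {0} = G {0} := by
  rw [Measure.map_apply (measurable_const_mul x₀) (measurableSet_singleton 0)]
  congr 1
  ext z
  simp [hx₀.ne']

theorem ennreal_le_liminf_add {ι : Type*} {l : Filter ι} (u v : ι → ℝ≥0∞) :
    liminf u l + liminf v l ≤ liminf (fun i => u i + v i) l := by
  rcases eq_or_ne (liminf u l) 0 with hu | hu
  · rw [hu, zero_add]
    exact liminf_le_liminf (Eventually.of_forall fun i => le_add_self)
  rcases eq_or_ne (liminf v l) 0 with hv | hv
  · rw [hv, add_zero]
    exact liminf_le_liminf (Eventually.of_forall fun i => le_self_add)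
  refine le_of_forall_lt fun c hc => ?_
  obtain ⟨a, ha, b, hb, hab⟩ := ENNReal.exists_lt_add_of_lt_add hc hu hv
  refine hab.trans_le (le_liminf_of_le (by isBoundedDefault) ?_)
  filter_upwards [eventually_lt_of_lt_liminf ha, eventually_lt_of_lt_liminf hb] with i hi hi'
  exact add_le_add hi.le hi'.le

/-- The set `{0}` is invariant under scaling, so the boundary condition can be used at time `s x`. A
zero boundary is thus automatically uniform. -/
theorem IsExtremalBoundary.le_liminf_scaledKernel_zero {K : Kernel ℝ≥0 ℝ≥0} {G : Measure ℝ≥0}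
    (hy : IsExtremalBoundary K G fun _ => 0) {x₀ : ℝ≥0} (hx₀ : 0 < x₀) :
    G {0} ≤ liminf (fun p : ℝ≥0 × ℝ≥0 => scaledKernel K p.1 p.2 {0}) (atTop ×ˢ 𝓝 x₀) := by
  have h := hy.tendsto_kernel.comp (tendsto_mul_atTop_nhds hx₀)
  refine h.liminf_eq.ge.trans_eq (liminf_congr ?_)
  filter_upwards [tendsto_fst.eventually (eventually_gt_atTop 0)] with p hp
  rw [scaledKernel, Kernel.map_apply' _ (by fun_prop) _ (measurableSet_singleton 0),
    Kernel.comap_apply]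
  simp only [Function.comp_apply, mul_zero]
  congr 1
  ext w
  simp [hp.ne']

variable {K : Kernel ℝ≥0 ℝ≥0} [IsMarkovKernel K] {G : Measure ℝ≥0} [IsProbabilityMeasure G]

theorem InDomainOfAttraction.le_liminf (hK : InDomainOfAttraction K G) {V : Set ℝ≥0}
    (hV : IsOpen V) : G V ≤ liminf (fun t : ℝ≥0 => (K t).map (fun x => x / t) V) atTop := by
  have h := ProbabilityMeasure.le_liminf_measure_open_of_tendsto hK
    (ENNReal.isOpenEmbedding_coe.isOpenMap V hV)
  simp only [scaledLaw_image_coe _ _ hV] at h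
  simpa using h

/-- With `u = s x`, the scaled kernel gives `A s` the mass that the law of `K(u, u ·)` gives to `{z
| x z ∈ A s}`. The bound is then Fatou's lemma for these indicators. The sets may vary with `s` so
that a neighbourhood of `0` shrinking with the boundary can be removed. -/
theorem InDomainOfAttraction.le_liminf_scaledKernel (hK : InDomainOfAttraction K G) {x₀ : ℝ≥0}
    (hx₀ : 0 < x₀) {U : Set ℝ≥0} (hU : MeasurableSet U) {A : ℝ≥0 → Set ℝ≥0}
    (hA : ∀ s, MeasurableSet (A s))
    (hUA : ∀ z ∈ U, ∀ᶠ q : ℝ≥0 × ℝ≥0 in atTop ×ˢ 𝓝 z, q.2 ∈ A q.1) :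
    G.map (fun z => x₀ * z) U
      ≤ liminf (fun p : ℝ≥0 × ℝ≥0 => scaledKernel K p.1 p.2 (A p.1)) (atTop ×ˢ 𝓝 x₀) := by
  have hB : ∀ p : ℝ≥0 × ℝ≥0, MeasurableSet {z | p.2 * z ∈ A p.1} := fun p =>
    measurable_const_mul p.2 (hA p.1)
  have hB₀ : MeasurableSet {z | x₀ * z ∈ U} := measurable_const_mul x₀ hU
  have key := lintegral_le_liminf_lintegral_of_isNhdsSystem (l := atTop ×ˢ 𝓝 x₀)
    isNhdsSystem_nhds (μ₀ := G)
    (μ := fun p : ℝ≥0 × ℝ≥0 => (K (p.1 * p.2)).map fun x => x / (p.1 * p.2))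
    (fun V hV => (hK.le_liminf (isOpen_iff_mem_nhds.2 hV)).trans
      (tendsto_mul_atTop_nhds hx₀).liminf_le_liminf_comp)
    (f := fun p => indicator {z | p.2 * z ∈ A p.1} 1) (f₀ := indicator {z | x₀ * z ∈ U} 1)
    (fun p => measurable_one.indicator (hB p)) (measurable_one.indicator hB₀)
    (fun p x => by unfold indicator; split_ifs <;> simp)
    (fun x => by unfold indicator; split_ifs <;> simp) ?_
  · rw [lintegral_indicator_one hB₀] at key
    rw [Measure.map_apply (measurable_const_mul x₀) hU]
    refine key.trans_eq (liminf_congr ?_)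
    filter_upwards [tendsto_snd.eventually (lt_mem_nhds hx₀)] with p hp
    rw [lintegral_indicator_one (hB p), Measure.map_apply (by fun_prop) (hB p), scaledKernel,
      Kernel.map_apply' _ (by fun_prop) _ (hA p.1), Kernel.comap_apply]
    congr 1
    ext w
    have : p.2 * (w / (p.1 * p.2)) = w / p.1 := by
      rw [mul_comm p.1, ← mul_div_assoc, mul_div_mul_left _ _ hp.ne']
    simp [this]
  · refine Eventually.of_forall fun z r hr => ?_
    by_cases hz : x₀ * z ∈ U
    · have hlim : Tendsto (fun q : (ℝ≥0 × ℝ≥0) × ℝ≥0 => (q.1.1, q.1.2 * q.2))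
          ((atTop ×ˢ 𝓝 x₀) ×ˢ 𝓝 z) (atTop ×ˢ 𝓝 (x₀ * z)) :=
        (tendsto_fst.comp tendsto_fst).prodMk
          ((tendsto_snd.comp tendsto_fst).mul tendsto_snd)
      filter_upwards [hlim.eventually (hUA _ hz)] with q hq
      have h1 : q.2 ∈ {z | q.1.2 * z ∈ A q.1.1} := hq
      have h2 : z ∈ {z | x₀ * z ∈ U} := hz
      rw [indicator_of_mem h1]
      rwa [indicator_of_mem h2] at hr
    · have h2 : z ∉ {z | x₀ * z ∈ U} := hz
      rw [indicator_of_notMem h2] at hr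
      exact absurd hr not_lt_zero

/-- The portmanteau lower bound for the kernels `Q s` at positive starting points, on sets that are
open for the neighbourhood system with filter `Z` at `0`. -/
def TailLimit (Q : ℝ≥0 → Kernel ℝ≥0 ℝ≥0) (G : Measure ℝ≥0) (Z : Filter ℝ≥0) : Prop :=
  ∀ x₀ : ℝ≥0, 0 < x₀ → ∀ U : Set ℝ≥0, (∀ x ∈ U, U ∈ nhdsWithZero Z x) →
    G.map (fun z => x₀ * z) U
      ≤ liminf (fun p : ℝ≥0 × ℝ≥0 => Q p.1 p.2 U) (atTop ×ˢ 𝓝 x₀)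

theorem InDomainOfAttraction.tailLimit_nhds (hK : InDomainOfAttraction K G) :
    TailLimit (scaledKernel K) G (𝓝 0) := by
  intro x₀ hx₀ U hU
  rw [nhdsWithZero_nhds] at hU
  have hUo : IsOpen U := isOpen_iff_mem_nhds.2 hU
  exact hK.le_liminf_scaledKernel hx₀ hUo.measurableSet (A := fun _ => U)
    (fun _ => hUo.measurableSet) fun z hz => tendsto_snd.eventually (hU z hz)


/-- When `0` is isolated, an open set is an ordinary open set avoiding `0`, possibly together with
the atom `{0}`. The two lower bounds add up. -/
theorem tailLimit_pure {G : Measure ℝ≥0} {Q : ℝ≥0 → Kernel ℝ≥0 ℝ≥0}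
    (hpos : ∀ x₀ : ℝ≥0, 0 < x₀ → ∀ U : Set ℝ≥0, IsOpen U → 0 ∉ U →
      G.map (fun z => x₀ * z) U
        ≤ liminf (fun p : ℝ≥0 × ℝ≥0 => Q p.1 p.2 U) (atTop ×ˢ 𝓝 x₀))
    (hzero : ∀ x₀ : ℝ≥0, 0 < x₀ →
      G {0} ≤ liminf (fun p : ℝ≥0 × ℝ≥0 => Q p.1 p.2 {0}) (atTop ×ˢ 𝓝 x₀)) :
    TailLimit Q G (pure 0) := by
  intro x₀ hx₀ U hU
  have hV : IsOpen (U \ {0}) := by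
    refine isOpen_iff_mem_nhds.2 fun x hx => ?_
    have hx0 : 0 < x := pos_iff_ne_zero.2 hx.2
    have := hU x hx.1
    rw [nhdsWithZero_of_pos _ hx0] at this
    filter_upwards [this, lt_mem_nhds hx0] with z hz hz0
    exact ⟨hz, hz0.ne'⟩
  by_cases h0 : (0 : ℝ≥0) ∈ U
  · have hUeq : U = U \ {0} ∪ {0} := by
      rw [sdiff_union_self, union_eq_left.2 (singleton_subset_iff.2 h0)]
    have hdisj : Disjoint (U \ {0}) {(0 : ℝ≥0)} := disjoint_sdiff_left
    calc G.map (fun z => x₀ * z) U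
        = G.map (fun z => x₀ * z) (U \ {0}) + G {0} := by
          rw [← map_mul_left_singleton_zero G hx₀,
            ← measure_union hdisj (measurableSet_singleton 0), ← hUeq]
      _ ≤ _ := add_le_add (hpos x₀ hx₀ _ hV fun h => h.2 rfl) (hzero x₀ hx₀)
      _ ≤ liminf (fun p : ℝ≥0 × ℝ≥0 => Q p.1 p.2 U) (atTop ×ˢ 𝓝 x₀) := by
          refine (ennreal_le_liminf_add _ _).trans_eq (liminf_congr (Eventually.of_forall ?_))
          intro p
          rw [← measure_union hdisj (measurableSet_singleton 0), ← hUeq]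
  · rw [← sdiff_singleton_eq_self h0]
    exact hpos x₀ hx₀ _ hV fun h => h.2 rfl

theorem InDomainOfAttraction.tailLimit_pure (hK : InDomainOfAttraction K G)
    (hzero : ∀ x₀ : ℝ≥0, 0 < x₀ →
      G {0} ≤ liminf (fun p : ℝ≥0 × ℝ≥0 => scaledKernel K p.1 p.2 {0}) (atTop ×ˢ 𝓝 x₀)) :
    TailLimit (scaledKernel K) G (pure 0) := by
  refine TailChain.tailLimit_pure (fun x₀ hx₀ U hU _ => ?_) hzero
  refine hK.tailLimit_nhds x₀ hx₀ U ?_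
  rw [nhdsWithZero_nhds]
  exact fun x hx => hU.mem_nhds hx

/-- Away from `0` killing is invisible in the limit, since `y s → 0` puts a neighbourhood of each
positive point above the boundary. At `0` the killed mass is that of `[0, y s]`, and uniformity
along functions is upgraded to continuous convergence. -/
theorem IsUniformExtremalBoundary.tailLimit_killedKernel {y : ℝ≥0 → ℝ≥0}
    (hK : InDomainOfAttraction K G) (hy : IsUniformExtremalBoundary K G y) :
    TailLimit (fun s => killedKernel (scaledKernel K s) (y s)) G (pure 0) := by
  refine tailLimit_pure (fun x₀ hx₀ U hU h0 => ?_) fun x₀ hx₀ => ?_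
  · refine (hK.le_liminf_scaledKernel hx₀ hU.measurableSet
      (A := fun s => U ∩ Ioi (y s)) (fun s => hU.measurableSet.inter measurableSet_Ioi) ?_).trans_eq
      (liminf_congr ?_)
    · intro z hz
      have hz0 : 0 < z := pos_iff_ne_zero.2 fun h => h0 (h ▸ hz)
      obtain ⟨r, hr0, hrz⟩ := exists_between hz0
      filter_upwards [tendsto_snd.eventually (hU.mem_nhds hz),
        tendsto_snd.eventually (lt_mem_nhds hrz),
        tendsto_fst.eventually (hy.tendsto_zero.eventually (gt_mem_nhds hr0))] with q h1 h2 h3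
      exact ⟨h1, h3.trans h2⟩
    · filter_upwards [tendsto_snd.eventually (lt_mem_nhds hx₀)] with p hp
      rw [killedKernel_of_pos _ _ hp, Measure.map_apply (measurable_truncate _) hU.measurableSet]
      congr 1
      ext z
      by_cases hz : z ≤ y p.1
      · simp [hz, h0]
      · simp [hz, not_le.1 hz]
  · have h := tendsto_of_forall_comp_tendsto
      (F := fun t u => K (t * u) (Iic (t * y t))) fun u hu => hy.uniform u x₀ hx₀ hu
    refine h.liminf_eq.ge.trans_eq (liminf_congr ?_)
    filter_upwards [tendsto_fst.eventually (eventually_gt_atTop 0),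
      tendsto_snd.eventually (lt_mem_nhds hx₀)] with p hp hp2
    rw [killedKernel_of_pos _ _ hp2,
      Measure.map_apply (measurable_truncate _) (measurableSet_singleton 0), scaledKernel,
      Kernel.map_apply' _ (by fun_prop) _ (measurable_truncate _ (measurableSet_singleton 0)),
      Kernel.comap_apply]
    congr 1
    ext w
    simp only [mem_Iic, mem_preimage, mem_singleton_iff, ite_eq_left_iff, not_le]
    rw [← div_le_iff₀' hp]
    refine ⟨fun h h' => absurd h h'.not_ge, fun h => ?_⟩
    by_contra hcon
    have := h (not_le.1 hcon)
    rw [this] at hcon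
    exact hcon bot_le

end TailLimits

/-! ### Continuous convergence of path expectations -/

section PathExpectations

/-- Continuous functions of `m` points of the compactified state space. -/
abbrev PathFun (m : ℕ) := C(Fin m → ℝ≥0∞, ℝ≥0)

/-- The value of `f` at a path in `[0,∞)`. -/
def PathFun.val {m : ℕ} (f : PathFun m) (w : Fin m → ℝ≥0) : ℝ≥0∞ := f fun i => (w i : ℝ≥0∞)

/-- The function of the remaining points when the first one is fixed. -/
def PathFun.tail {m : ℕ} (f : PathFun (m + 1)) (x : ℝ≥0) : PathFun m where
  toFun w := f (Fin.cons (x : ℝ≥0∞) w : Fin (m + 1) → ℝ≥0∞)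
  continuous_toFun := f.continuous.comp (continuous_const.finCons continuous_id)

namespace PathFun

variable {m : ℕ}

theorem measurable_val (f : PathFun m) : Measurable f.val := by
  refine measurable_coe_nnreal_ennreal.comp (f.continuous.measurable.comp ?_)
  fun_prop

theorem val_cons (f : PathFun (m + 1)) (x : ℝ≥0) (w : Fin m → ℝ≥0) :
    f.val (Fin.cons x w) = (f.tail x).val w := by
  unfold val tail
  simp only [ContinuousMap.coe_mk]
  congr 2
  ext i
  refine Fin.cases ?_ (fun j => ?_) i <;> simp

/-- Joint continuity is what lets the induction absorb the current point into the test function. -/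
theorem continuous_tail : Continuous fun p : ℝ≥0 × PathFun (m + 1) => p.2.tail p.1 := by
  refine ContinuousMap.continuous_of_continuous_uncurry _ ?_
  have h : Continuous fun q : (ℝ≥0 × PathFun (m + 1)) × (Fin m → ℝ≥0∞) =>
      (Fin.cons (q.1.1 : ℝ≥0∞) q.2 : Fin (m + 1) → ℝ≥0∞) :=
    Continuous.finCons (by fun_prop) continuous_snd
  exact ContinuousEval.continuous_eval.comp ((continuous_snd.comp continuous_fst).prodMk h)

theorem tail_val_zero (f : PathFun (m + 1)) : (f.tail 0).val 0 = f 0 := by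
  rw [← val_cons, val]
  congr 2
  ext i
  refine Fin.cases ?_ (fun j => ?_) i <;> simp

theorem continuous_val (w : Fin m → ℝ≥0) : Continuous fun f : PathFun m => f.val w :=
  ENNReal.continuous_coe.comp (ContinuousEvalConst.continuous_eval_const _)

/-- Supplies a constant dominating all test functions near `f₀`; for probability kernels its
integrals converge trivially. -/
theorem exists_eventually_val_le (f₀ : PathFun m) :
    ∃ C : ℝ≥0, ∀ᶠ f in 𝓝 f₀, ∀ w, PathFun.val f w ≤ C := by
  obtain ⟨C, hC⟩ := (isCompact_range f₀.continuous).bddAbove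
  refine ⟨C + 1, ?_⟩
  have hm : MapsTo f₀ univ (Iio (C + 1)) := fun w _ =>
    lt_of_le_of_lt (hC (mem_range_self w)) (lt_add_one C)
  filter_upwards [ContinuousMap.eventually_mapsTo isCompact_univ isOpen_Iio hm] with f hf w
  exact ENNReal.coe_le_coe.2 (le_of_lt (hf (mem_univ _)))

end PathFun

/-- The expectation of a function of the first `m` steps of the chain with kernel `Q s`, started at
`x`, as a function of `(s, x, f)`. -/
def pathExpect (Q : ℝ≥0 → Kernel ℝ≥0 ℝ≥0) (m : ℕ) (p : ℝ≥0 × ℝ≥0 × PathFun m) : ℝ≥0∞ :=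
  ∫⁻ w, p.2.2.val w ∂pathKernel (Q p.1) m p.2.1

/-- The expectation of a function of the starting point `x` and the first `m` steps, as a function
of `(s, x, f)`. -/
def pathExpectCons (Q : ℝ≥0 → Kernel ℝ≥0 ℝ≥0) (m : ℕ) (p : ℝ≥0 × ℝ≥0 × PathFun (m + 1)) :
    ℝ≥0∞ :=
  pathExpect Q m (p.1, p.2.1, p.2.2.tail p.2.1)

theorem measurable_lintegral_tail (K : Kernel ℝ≥0 ℝ≥0) [IsMarkovKernel K] {m : ℕ}
    (f : PathFun (m + 1)) : Measurable fun z => ∫⁻ w, (f.tail z).val w ∂pathKernel K m z := by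
  simp_rw [← PathFun.val_cons]
  exact measurable_lintegral_pathKernel K m f.measurable_val

theorem lintegral_val_pathKernel_succ (K : Kernel ℝ≥0 ℝ≥0) [IsMarkovKernel K] {m : ℕ}
    (f : PathFun (m + 1)) (x : ℝ≥0) :
    ∫⁻ w, f.val w ∂pathKernel K (m + 1) x
      = ∫⁻ z, ∫⁻ w, (f.tail z).val w ∂pathKernel K m z ∂K x := by
  simp_rw [← PathFun.val_cons]
  exact lintegral_pathKernel_succ K m x f.measurable_val

theorem lintegral_tail_le (K : Kernel ℝ≥0 ℝ≥0) [IsMarkovKernel K] {m : ℕ}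
    {f : PathFun (m + 1)} {C : ℝ≥0} (hf : ∀ w, f.val w ≤ C) (z : ℝ≥0) :
    ∫⁻ w, (f.tail z).val w ∂pathKernel K m z ≤ C := by
  calc ∫⁻ w, (f.tail z).val w ∂pathKernel K m z ≤ ∫⁻ _, (C : ℝ≥0∞) ∂pathKernel K m z :=
        lintegral_mono fun w => by rw [← PathFun.val_cons]; exact hf _
    _ = C := by simp

theorem tendsto_pathExpect_zero (Q : ℝ≥0 → Kernel ℝ≥0 ℝ≥0) (Y : Filter ℝ≥0)
    (S : Set (PathFun 0)) (f₀ : PathFun 0) :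
    Tendsto (pathExpect Q 0) (atTop ×ˢ Y ×ˢ 𝓝[S] f₀) (𝓝 (f₀.val Fin.elim0)) := by
  have h : pathExpect Q 0 = fun p => p.2.2.val Fin.elim0 :=
    funext fun p => lintegral_pathKernel_zero _ _ _
  rw [h]
  exact (((PathFun.continuous_val _).tendsto f₀).mono_left nhdsWithin_le_nhds).comp
    (tendsto_snd.comp tendsto_snd)

variable {Q : ℝ≥0 → Kernel ℝ≥0 ℝ≥0} [∀ s, IsMarkovKernel (Q s)]

/-- One step of the induction for path expectations. -/
theorem tendsto_pathExpect_succ {N : ℝ≥0 → Filter ℝ≥0} (hN : IsNhdsSystem N) {m : ℕ}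
    {S : Set (PathFun (m + 1))} {f₀ : PathFun (m + 1)} {Y : Filter ℝ≥0} [Y.IsCountablyGenerated]
    {μ₀ : Measure ℝ≥0} [IsProbabilityMeasure μ₀] {g₀ : ℝ≥0 → ℝ≥0∞} (hg₀ : Measurable g₀)
    (hg₀_le : ∀ C : ℝ≥0, (∀ w, f₀.val w ≤ C) → ∀ x, g₀ x ≤ C)
    (hμ : ∀ U : Set ℝ≥0, (∀ x ∈ U, U ∈ N x) →
      μ₀ U ≤ liminf (fun p : ℝ≥0 × ℝ≥0 => Q p.1 p.2 U) (atTop ×ˢ Y))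
    (hlim : ∀ᵐ x ∂μ₀, Tendsto (pathExpectCons Q m) (atTop ×ˢ N x ×ˢ 𝓝[S] f₀) (𝓝 (g₀ x))) :
    Tendsto (pathExpect Q (m + 1)) (atTop ×ˢ Y ×ˢ 𝓝[S] f₀) (𝓝 (∫⁻ x, g₀ x ∂μ₀)) := by
  obtain ⟨C, hC⟩ := f₀.exists_eventually_val_le
  have hproj : Tendsto (fun p : ℝ≥0 × ℝ≥0 × PathFun (m + 1) => (p.1, p.2.1))
      (atTop ×ˢ Y ×ˢ 𝓝[S] f₀) (atTop ×ˢ Y) :=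
    tendsto_fst.prodMk (tendsto_fst.comp tendsto_snd)
  have key := tendsto_lintegral_of_isNhdsSystem (l := atTop ×ˢ Y ×ˢ 𝓝[S] f₀) hN (μ₀ := μ₀)
    (μ := fun p : ℝ≥0 × ℝ≥0 × PathFun (m + 1) => Q p.1 p.2.1)
    (fun U hU => (hμ U hU).trans hproj.liminf_le_liminf_comp)
    (f := fun p z => ∫⁻ w, (p.2.2.tail z).val w ∂pathKernel (Q p.1) m z)
    (h := fun _ => C) (fun p => measurable_lintegral_tail (Q p.1) p.2.2) hg₀ measurable_const
    ?_ (hg₀_le C hC.self_of_nhds) (fun _ => ENNReal.coe_ne_top) (fun _ => tendsto_const_nhds)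
    (by simpa using tendsto_const_nhds) (by simp) ?_
  · refine key.congr fun p => ?_
    exact (lintegral_val_pathKernel_succ (Q p.1) p.2.2 p.2.1).symm
  · filter_upwards [(tendsto_snd.comp tendsto_snd).eventually (hC.filter_mono nhdsWithin_le_nhds)]
      with p hp x
    exact lintegral_tail_le (Q p.1) hp x
  · filter_upwards [hlim] with x hx
    have hmap : Tendsto (fun q : (ℝ≥0 × ℝ≥0 × PathFun (m + 1)) × ℝ≥0 => (q.1.1, q.2, q.1.2.2))
        ((atTop ×ˢ Y ×ˢ 𝓝[S] f₀) ×ˢ N x) (atTop ×ˢ N x ×ˢ 𝓝[S] f₀) :=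
      (tendsto_fst.comp tendsto_fst).prodMk (tendsto_snd.prodMk
        (tendsto_snd.comp (tendsto_snd.comp tendsto_fst)))
    exact hx.comp hmap

theorem tendsto_tail {m : ℕ} {S : Set (PathFun (m + 1))} {T : Set (PathFun m)}
    (hST : ∀ f ∈ S, ∀ x, PathFun.tail f x ∈ T) (f₀ : PathFun (m + 1)) (x : ℝ≥0) {l : Filter ℝ≥0}
    (hl : l ≤ 𝓝 x) :
    Tendsto (fun p : ℝ≥0 × ℝ≥0 × PathFun (m + 1) => (p.1, p.2.1, p.2.2.tail p.2.1))
      (atTop ×ˢ l ×ˢ 𝓝[S] f₀) (atTop ×ˢ l ×ˢ 𝓝[T] (f₀.tail x)) := by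
  refine tendsto_fst.prodMk ((tendsto_fst.comp tendsto_snd).prodMk
    (tendsto_nhdsWithin_iff.2 ⟨?_, ?_⟩))
  · have h : Tendsto (fun p : ℝ≥0 × ℝ≥0 × PathFun (m + 1) => p.2)
        (atTop ×ˢ l ×ˢ 𝓝[S] f₀) (𝓝 (x, f₀)) := by
      rw [nhds_prod_eq]
      exact tendsto_snd.mono_right (Filter.prod_mono hl nhdsWithin_le_nhds)
    exact (PathFun.continuous_tail.tendsto (x, f₀)).comp h
  · filter_upwards [(tendsto_snd.comp tendsto_snd).eventually self_mem_nhdsWithin] with p hp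
    exact hST _ hp _

variable {G : Measure ℝ≥0} [IsProbabilityMeasure G] {Z : Filter ℝ≥0}

/-- Convergence of path expectations, started at positive points, to those of the tail chain, for
classes `S m` of functions for which the behaviour of the chain near `0` is controlled. -/
theorem tendsto_pathExpect (hN : IsNhdsSystem (nhdsWithZero Z))
    (hQ : TailLimit Q G Z) {S : ∀ m, Set (PathFun m)}
    (hS : ∀ m, ∀ f ∈ S (m + 1), ∀ x, PathFun.tail f x ∈ S m)
    (hzero : ∀ m, ∀ f₀ ∈ S (m + 1), Tendsto (pathExpectCons Q m)
      (atTop ×ˢ Z ×ˢ 𝓝[S (m + 1)] f₀) (𝓝 ((f₀ : PathFun (m + 1)) 0 : ℝ≥0∞)))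
    (m : ℕ) {f₀ : PathFun m} (hf₀ : f₀ ∈ S m) {x₀ : ℝ≥0} (hx₀ : 0 < x₀) :
    Tendsto (pathExpect Q m) (atTop ×ˢ 𝓝 x₀ ×ˢ 𝓝[S m] f₀)
      (𝓝 (∫⁻ w, f₀.val w ∂pathKernel (tailKernel G (Measure.dirac 0)) m x₀)) := by
  induction m generalizing x₀ with
  | zero =>
    rw [lintegral_pathKernel_zero]
    exact tendsto_pathExpect_zero _ _ _ _
  | succ m ih =>
    rw [lintegral_val_pathKernel_succ]
    refine tendsto_pathExpect_succ hN (measurable_lintegral_tail _ f₀)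
      (fun C hC x => lintegral_tail_le _ hC x) ?_ (Eventually.of_forall fun x => ?_)
    · rw [tailKernel_of_pos G hx₀]
      exact hQ x₀ hx₀
    -- At `0` the tail chain stays put, so the limit is the value at the zero path and the control
    -- near `0` is assumed. At positive points the induction hypothesis applies.
    · rcases eq_or_ne x 0 with rfl | hx
      · rw [nhdsWithZero_zero, lintegral_pathKernel_of_absorbing (tailKernel_zero G) m
          (PathFun.measurable_val _), PathFun.tail_val_zero]
        exact hzero m f₀ hf₀
      · have hx' := pos_iff_ne_zero.2 hx
        rw [nhdsWithZero_of_pos Z hx']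
        exact (ih (hS m f₀ hf₀ x) hx').comp (tendsto_tail (hS m) f₀ x le_rfl)

/-- Convergence of path expectations started near `0`, under the regularity condition. -/
theorem tendsto_pathExpect_nhds_zero
    (hQ : ∀ U : Set ℝ≥0, IsOpen U → Measure.dirac 0 U
      ≤ liminf (fun p : ℝ≥0 × ℝ≥0 => Q p.1 p.2 U) (atTop ×ˢ 𝓝 0)) (m : ℕ) (f₀ : PathFun m) :
    Tendsto (pathExpect Q m) (atTop ×ˢ 𝓝 0 ×ˢ 𝓝[univ] f₀) (𝓝 (f₀.val 0)) := by
  induction m with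
  | zero =>
    rw [Subsingleton.elim (0 : Fin 0 → ℝ≥0) Fin.elim0]
    exact tendsto_pathExpect_zero _ _ _ _
  | succ m ih =>
    have h : ∫⁻ _, f₀.val 0 ∂(Measure.dirac (0 : ℝ≥0)) = f₀.val 0 := by simp
    rw [← h]
    refine tendsto_pathExpect_succ isNhdsSystem_nhds measurable_const (fun C hC _ => hC _)
      (fun U hU => hQ U (isOpen_iff_mem_nhds.2 hU)) ?_
    rw [ae_dirac_eq]
    change Tendsto _ _ _
    have h1 : f₀.val 0 = (f₀.tail 0).val 0 := by
      rw [PathFun.tail_val_zero]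
      rfl
    rw [h1]
    exact (ih (f₀.tail 0)).comp (tendsto_tail (fun _ _ _ => mem_univ _) f₀ 0 le_rfl)

end PathExpectations

/-! ### Vague convergence and the scaled initial law -/

section InitialLaw

/-- A compactly supported continuous function on an open set extends by zero to a continuous
function on the ambient space. -/
theorem vagueTendstoOn_of_forall_continuousMap {E ι : Type*} [TopologicalSpace E] [T2Space E]
    [MeasurableSpace E] [BorelSpace E] {S : Set E} (hS : IsOpen S) {l : Filter ι}
    {μ : ι → Measure E} {ν : Measure E} (hμ : ∀ᶠ i in l, IsFiniteMeasure (μ i))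
    (hν : ∀ A ⊆ S, IsCompact A → ν A < ∞)
    (h : ∀ f : C(E, ℝ≥0), ∀ A ⊆ S, IsCompact A → (∀ x ∉ A, f x = 0) →
      Tendsto (fun i => ∫⁻ x, (f x : ℝ≥0∞) ∂(μ i)) l (𝓝 (∫⁻ x, (f x : ℝ≥0∞) ∂ν))) :
    VagueTendstoOn S l μ ν := by
  have hcomap : ∀ (ρ : Measure E) (A : Set S),
      ρ.comap (Subtype.val : S → E) A = ρ (Subtype.val '' A) := fun ρ A =>
    (MeasurableEmbedding.subtype_coe hS.measurableSet).comap_apply ρ A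
  refine ⟨hμ.mono fun i hi => ⟨fun A _ => ?_⟩, ⟨fun A hA => ?_⟩, fun f => ?_⟩
  · rw [hcomap]
    exact measure_lt_top _ _
  · rw [hcomap]
    exact hν _ (Subtype.coe_image_subset S A) (hA.image continuous_subtype_val)
  · set F : C(E, ℝ≥0) := ⟨Function.extend (Subtype.val : S → E) f (0 : E → ℝ≥0),
      f.hasCompactSupport.continuous_extend_zero hS f.continuous⟩ with hF
    have hFS : ∀ x : S, F x = f x := fun x => Subtype.val_injective.extend_apply _ _ x
    set A : Set E := Subtype.val '' tsupport f with hA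
    have hAS : A ⊆ S := Subtype.coe_image_subset S _
    have hFA : ∀ x ∉ A, F x = 0 := by
      intro x hx
      by_cases hxS : x ∈ S
      · rw [hFS ⟨x, hxS⟩]
        exact image_eq_zero_of_notMem_tsupport fun h => hx ⟨_, h, rfl⟩
      · refine Function.extend_apply' _ _ x fun ⟨y, hy⟩ => hxS (hy ▸ y.2)
    have hint : ∀ ρ : Measure E, ∫⁻ x, (f x : ℝ≥0∞) ∂(ρ.comap (Subtype.val : S → E))
        = ∫⁻ x, (F x : ℝ≥0∞) ∂ρ := by
      intro ρ
      simp_rw [← hFS]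
      rw [lintegral_subtype_comap hS.measurableSet fun x => (F x : ℝ≥0∞)]
      refine setLIntegral_eq_of_support_subset (Function.support_subset_iff'.2 fun x hx => ?_)
      rw [hFA x fun h => hx (hAS h), ENNReal.coe_zero]
    simp_rw [hint]
    exact h F A hAS (f.hasCompactSupport.image continuous_subtype_val) hFA

theorem nuAlpha_singleton_zero (α : ℝ) : nuAlpha α {0} = 0 := by
  have hpre : Real.toNNReal ⁻¹' {0} = Iic 0 := by
    ext z
    simp
  rw [nuAlpha, Measure.map_apply measurable_real_toNNReal (measurableSet_singleton 0), hpre,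
    withDensity_apply _ measurableSet_Iic, Measure.restrict_restrict measurableSet_Iic,
    Iic_inter_Ioi, Ioc_self, Measure.restrict_empty, lintegral_zero_measure]

/-- The law of the initial value in units of `s`, with total mass `t`. -/
def initialMeasure (H : Measure ℝ≥0) (t s : ℝ≥0) : Measure ℝ≥0 := t • H.map fun x => x / s

theorem lintegral_initialMeasure (H : Measure ℝ≥0) (t s : ℝ≥0) {F : ℝ≥0 → ℝ≥0∞}
    (hF : Measurable F) :
    ∫⁻ x, F x ∂initialMeasure H t s = t * ∫⁻ x, F (x / s) ∂H := by
  rw [initialMeasure, lintegral_smul_measure, lintegral_map hF (by fun_prop)]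
  rfl

variable {H : Measure ℝ≥0} {α : ℝ} {b : ℝ≥0 → ℝ≥0}

/-- Since `[δ,∞]` is compact in `(0,∞]`, such a function is a legitimate test function for vague
convergence on the cone. -/
theorem tendsto_lintegral_initialMeasure_of_continuousMap
    (hH : VagueTendstoOn posCone atTop
      (fun t : ℝ≥0 => t • H.map fun x : ℝ≥0 => ((x / b t : ℝ≥0) : ℝ≥0∞)) (nuAlphaE α))
    (f : C(ℝ≥0∞, ℝ≥0)) {δ : ℝ≥0} (hδ : 0 < δ) (hf : ∀ x ≤ (δ : ℝ≥0∞), f x = 0) :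
    Tendsto (fun t => ∫⁻ x, (f (x : ℝ≥0∞) : ℝ≥0∞) ∂initialMeasure H t (b t)) atTop
      (𝓝 (∫⁻ x : ℝ≥0, (f (x : ℝ≥0∞) : ℝ≥0∞) ∂nuAlpha α)) := by
  have hSm : MeasurableSet posCone := measurableSet_Ioi
  have hδ' : (0 : ℝ≥0∞) < δ := ENNReal.coe_pos.2 hδ
  have hcpt : HasCompactSupport fun x : posCone => f x := by
    refine HasCompactSupport.intro (K := Subtype.val ⁻¹' Icc (δ : ℝ≥0∞) ⊤) ?_ fun x hx => ?_
    · rw [Subtype.isCompact_iff, Subtype.image_preimage_coe, inter_eq_right.2]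
      · exact isCompact_Icc
      · exact fun x hx => hδ'.trans_le hx.1
    · exact hf _ (le_of_not_ge fun h => hx ⟨h, le_top⟩)
  have h := hH.tendsto ⟨⟨fun x => f x, by fun_prop⟩, hcpt⟩
  have hint : ∀ ρ : Measure ℝ≥0∞, ∫⁻ x : posCone, (f x : ℝ≥0∞) ∂(ρ.comap Subtype.val)
      = ∫⁻ x, (f x : ℝ≥0∞) ∂ρ := by
    intro ρ
    rw [lintegral_subtype_comap hSm fun x => (f x : ℝ≥0∞)]
    refine setLIntegral_eq_of_support_subset (Function.support_subset_iff'.2 fun x hx => ?_)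
    rw [hf x ((not_lt.1 hx).trans bot_le), ENNReal.coe_zero]
  have hfm : Measurable fun x => (f x : ℝ≥0∞) :=
    measurable_coe_nnreal_ennreal.comp f.continuous.measurable
  have h' : Tendsto (fun t : ℝ≥0 => ∫⁻ x, (f x : ℝ≥0∞)
      ∂(t • H.map fun x : ℝ≥0 => ((x / b t : ℝ≥0) : ℝ≥0∞))) atTop
      (𝓝 (∫⁻ x, (f x : ℝ≥0∞) ∂nuAlphaE α)) := by
    rw [← hint]
    simp_rw [← hint]
    exact h
  rw [nuAlphaE, lintegral_map hfm measurable_coe_nnreal_ennreal] at h'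
  refine h'.congr fun t => ?_
  rw [lintegral_smul_measure, lintegral_map hfm (measurable_scale _)]
  exact (lintegral_initialMeasure _ _ _ (hfm.comp measurable_coe_nnreal_ennreal)).symm

theorem exists_continuousMap_one_zero {A B : Set ℝ≥0∞} (hA : IsClosed A) (hB : IsClosed B)
    (hAB : Disjoint A B) :
    ∃ f : C(ℝ≥0∞, ℝ≥0), (∀ x ∈ A, f x = 0) ∧ (∀ x ∈ B, f x = 1) ∧ ∀ x, f x ≤ 1 := by
  obtain ⟨f, hf0, hf1, hf⟩ := exists_continuous_zero_one_of_isClosed hA hB hAB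
  refine ⟨⟨fun x => (f x).toNNReal, by fun_prop⟩, fun x hx => ?_, fun x hx => ?_, fun x => ?_⟩
  · simp [hf0 hx]
  · simp [hf1 hx]
  · simpa using (hf x).2

/-- The point `0` is null, and `U \ {0}` is an increasing union of compact sets. Each of these stays
away from `0`, so a Urysohn function supported near it is an admissible test function. -/
theorem nuAlpha_le_liminf_initialMeasure
    (hH : VagueTendstoOn posCone atTop
      (fun t : ℝ≥0 => t • H.map fun x : ℝ≥0 => ((x / b t : ℝ≥0) : ℝ≥0∞)) (nuAlphaE α))
    {U : Set ℝ≥0} (hU : IsOpen U) :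
    nuAlpha α U ≤ liminf (fun t => initialMeasure H t (b t) U) atTop := by
  obtain ⟨F, hFc, -, hFU, hFm⟩ :=
    (hU.sdiff (isClosed_singleton (x := (0 : ℝ≥0)))).exists_iUnion_isClosed
  set A : ℕ → Set ℝ≥0 := fun n => F n ∩ Iic (n : ℝ≥0) with hA
  have hAm : Monotone A := fun m n hmn =>
    inter_subset_inter (hFm hmn) (Iic_subset_Iic.2 (Nat.cast_le.2 hmn))
  have hAU : U \ {0} ⊆ ⋃ n, A n := by
    intro x hx
    rw [← hFU] at hx
    obtain ⟨m, hm⟩ := mem_iUnion.1 hx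
    obtain ⟨n, hn⟩ := exists_nat_ge x
    exact mem_iUnion.2 ⟨max m n, hFm (le_max_left _ _) hm,
      hn.trans (Nat.cast_le.2 (le_max_right _ _))⟩
  have h1 : nuAlpha α U ≤ nuAlpha α (⋃ n, A n) := by
    rw [← measure_sdiff_null (nuAlpha_singleton_zero α)]
    exact measure_mono hAU
  refine h1.trans ?_
  rw [hAm.measure_iUnion]
  refine iSup_le fun n => ?_
  have hAc : IsCompact (A n) := by
    have : A n = F n ∩ Icc 0 (n : ℝ≥0) := by
      ext x
      simp [hA]
    rw [this]
    exact isCompact_Icc.inter_left (hFc n)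
  have hAU' : A n ⊆ U \ {0} := fun x hx => hFU ▸ mem_iUnion.2 ⟨n, hx.1⟩
  obtain ⟨δ, hδ, hδA⟩ : ∃ δ : ℝ≥0, 0 < δ ∧ A n ⊆ Ioi δ := by
    rcases (A n).eq_empty_or_nonempty with h | h
    · exact ⟨1, one_pos, h ▸ empty_subset _⟩
    · obtain ⟨c, hc, hc'⟩ := hAc.exists_isLeast h
      obtain ⟨δ, hδ, hδc⟩ := exists_between (pos_iff_ne_zero.2 (hAU' hc).2)
      exact ⟨δ, hδ, fun x hx => hδc.trans_le (hc' hx)⟩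
  have hV : IsOpen ((fun x : ℝ≥0 => (x : ℝ≥0∞)) '' (U ∩ Ioi δ)) :=
    ENNReal.isOpenEmbedding_coe.isOpenMap _ (hU.inter isOpen_Ioi)
  obtain ⟨f, hf0, hf1, hfle⟩ := exists_continuousMap_one_zero hV.isClosed_compl
    (hAc.image ENNReal.continuous_coe).isClosed
    (disjoint_compl_left_iff_subset.2 (image_mono fun x hx => ⟨(hAU' hx).1, hδA hx⟩))
  have hfδ : ∀ x ≤ (δ : ℝ≥0∞), f x = 0 := by
    refine fun x hx => hf0 x ?_
    rintro ⟨z, hz, rfl⟩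
    exact absurd hx (ENNReal.coe_lt_coe.2 hz.2).not_ge
  have hlim := tendsto_lintegral_initialMeasure_of_continuousMap hH f hδ hfδ
  calc nuAlpha α (A n) = ∫⁻ x, indicator (A n) 1 x ∂nuAlpha α :=
        (lintegral_indicator_one hAc.measurableSet).symm
    _ ≤ ∫⁻ x : ℝ≥0, (f (x : ℝ≥0∞) : ℝ≥0∞) ∂nuAlpha α := by
        refine lintegral_mono fun x => ?_
        by_cases hx : x ∈ A n
        · rw [indicator_of_mem hx, hf1 _ (mem_image_of_mem _ hx)]
          rfl
        · rw [indicator_of_notMem hx]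
          exact bot_le
    _ = liminf (fun t => ∫⁻ x, (f (x : ℝ≥0∞) : ℝ≥0∞) ∂initialMeasure H t (b t)) atTop :=
        hlim.liminf_eq.symm
    _ ≤ _ := by
        refine liminf_le_liminf (Eventually.of_forall fun t => ?_)
        rw [← lintegral_indicator_one hU.measurableSet]
        refine lintegral_mono fun x => ?_
        by_cases hx : x ∈ U
        · rw [indicator_of_mem hx]
          exact ENNReal.coe_le_coe.2 (hfle x)
        · rw [hf0]
          · exact bot_le
          · rintro ⟨z, hz, hzx⟩
            exact hx (ENNReal.coe_injective hzx ▸ hz.1)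

/-- Convergence of integrals with respect to the scaled initial law of uniformly bounded functions
vanishing near `0` and converging continuously on `(0,∞)`. -/
theorem tendsto_lintegral_initialMeasure (hα : 0 < α) (hb : Tendsto b atTop atTop)
    (hH : VagueTendstoOn posCone atTop
      (fun t : ℝ≥0 => t • H.map fun x : ℝ≥0 => ((x / b t : ℝ≥0) : ℝ≥0∞)) (nuAlphaE α))
    {g : ℝ≥0 → ℝ≥0 → ℝ≥0∞} {g₀ : ℝ≥0 → ℝ≥0∞} (hg : ∀ s, Measurable (g s)) (hg₀ : Measurable g₀)
    {C δ : ℝ≥0} (hδ : 0 < δ) (hgC : ∀ s x, g s x ≤ C) (hg₀C : ∀ x, g₀ x ≤ C)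
    (hgδ : ∀ s, ∀ x ≤ δ, g s x = 0) (hg₀δ : ∀ x ≤ δ, g₀ x = 0)
    (hlim : ∀ x₀ : ℝ≥0, 0 < x₀ →
      Tendsto (fun p : ℝ≥0 × ℝ≥0 => g p.1 p.2) (atTop ×ˢ 𝓝 x₀) (𝓝 (g₀ x₀))) :
    Tendsto (fun t => ∫⁻ x, g (b t) x ∂initialMeasure H t (b t)) atTop
      (𝓝 (∫⁻ x, g₀ x ∂nuAlpha α)) := by
  -- The gap between `ε` and `δ` leaves room for a continuous dominating function equal to `C` on
  -- `[δ,∞]` and vanishing on `[0,ε]`.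
  obtain ⟨ε, hε, hεδ⟩ := exists_between hδ
  obtain ⟨φ, hφ0, hφ1, hφle⟩ := exists_continuousMap_one_zero (A := Iic (ε : ℝ≥0∞))
    (B := Ici (δ : ℝ≥0∞)) isClosed_Iic isClosed_Ici
    ((Iic_disjoint_Ici).2 (ENNReal.coe_lt_coe.2 hεδ).not_ge)
  set f : C(ℝ≥0∞, ℝ≥0) := ⟨fun x => C * φ x, by fun_prop⟩ with hf
  have hf1 : ∀ x : ℝ≥0, δ ≤ x → (f x : ℝ≥0∞) = C := fun x hx => by
    simp [hf, hφ1 x (ENNReal.coe_le_coe.2 hx)]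
  have hf0 : ∀ x ≤ (ε : ℝ≥0∞), f x = 0 := fun x hx => by simp [hf, hφ0 x hx]
  have hdom : ∀ {u : ℝ≥0 → ℝ≥0∞}, (∀ x, u x ≤ C) → (∀ x ≤ δ, u x = 0) →
      ∀ x : ℝ≥0, u x ≤ (f x : ℝ≥0∞) := by
    intro u hu hu0 x
    rcases le_total x δ with hx | hx
    · rw [hu0 x hx]
      exact bot_le
    · rw [hf1 x hx]
      exact hu x
  have hfin : ∫⁻ x : ℝ≥0, (f x : ℝ≥0∞) ∂nuAlpha α ≠ ∞ := by
    have : ∫⁻ x : ℝ≥0, (f x : ℝ≥0∞) ∂nuAlpha α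
        ≤ ∫⁻ x, (Ioi ε).indicator (fun _ => (C : ℝ≥0∞)) x ∂nuAlpha α := by
      refine lintegral_mono fun x => ?_
      by_cases hx : x ∈ Ioi ε
      · rw [indicator_of_mem hx]
        exact ENNReal.coe_le_coe.2 (mul_le_of_le_one_right bot_le (hφle x))
      · rw [hf0 x (ENNReal.coe_le_coe.2 (not_lt.1 hx))]
        exact bot_le
    refine ne_top_of_le_ne_top ?_ this
    rw [lintegral_indicator_const measurableSet_Ioi, nuAlpha_Ioi hα hε]
    exact ENNReal.mul_ne_top ENNReal.coe_ne_top ENNReal.ofReal_ne_top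
  refine tendsto_lintegral_of_isNhdsSystem isNhdsSystem_nhds
    (fun U hU => nuAlpha_le_liminf_initialMeasure hH (isOpen_iff_mem_nhds.2 hU))
    (h := fun x => (f x : ℝ≥0∞)) (fun t => hg (b t)) hg₀ ?_
    (Eventually.of_forall fun t => hdom (hgC _) (hgδ _)) (hdom hg₀C hg₀δ)
    (fun x => ENNReal.coe_ne_top) (fun x => ?_)
    (tendsto_lintegral_initialMeasure_of_continuousMap hH f hε hf0) hfin ?_
  · exact measurable_coe_nnreal_ennreal.comp
      (f.continuous.measurable.comp measurable_coe_nnreal_ennreal)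
  · exact (ENNReal.continuous_coe.comp (f.continuous.comp ENNReal.continuous_coe)).tendsto x
  · have hae : ∀ᵐ x ∂nuAlpha α, x ≠ 0 := by
      rw [ae_iff]
      simpa using nuAlpha_singleton_zero α
    filter_upwards [hae] with x hx
    exact (hlim x (pos_iff_ne_zero.2 hx)).comp ((hb.comp tendsto_fst).prodMk tendsto_snd)

end InitialLaw

/-! ### Assembling the chain, and survival probabilities -/

section Survival

theorem lt_tau_iff {Ω : Type*} (X : ℕ → Ω → ℝ≥0) (y : ℝ≥0 → ℝ≥0) (t : ℝ≥0) (n : ℕ) (ω : Ω) :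
    (n : ℕ∞) < tau X y t ω ↔ ∀ j ≤ n, t * y t < X j ω := by
  constructor
  · intro h j hj
    by_contra hcon
    have h1 : tau X y t ω ≤ (j : ℕ∞) :=
      iInf₂_le (f := fun (n : ℕ) (_ : X n ω ≤ t * y t) => (n : ℕ∞)) j (not_lt.1 hcon)
    exact absurd (h.trans_le h1) (Nat.cast_le.2 hj).not_gt
  · intro h
    have h1 : ((n + 1 : ℕ) : ℕ∞) ≤ tau X y t ω := by
      refine le_iInf₂ fun k hk => Nat.cast_le.2 ?_
      by_contra hcon
      exact (h k (by omega)).not_ge hk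
    exact lt_of_lt_of_le (Nat.cast_lt.2 n.lt_succ_self) h1

theorem extremalComponent_eq_killPath {Ω : Type*} (X : ℕ → Ω → ℝ≥0) (y : ℝ≥0 → ℝ≥0) (t : ℝ≥0)
    {m : ℕ} (i : Fin m) (ω : Ω) :
    extremalComponent X y t i ω = killPath (t * y t) (fun j : Fin m => X j ω) i := by
  unfold extremalComponent killPath
  simp only [lt_tau_iff]
  refine if_congr ⟨fun h j hj => h j hj, fun h j hj => ?_⟩ rfl rfl
  exact h ⟨j, hj.trans_lt i.2⟩ hj

theorem lintegral_nuStar (G : Measure ℝ≥0) [IsProbabilityMeasure G] (α : ℝ) (m : ℕ)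
    {F : (Fin (m + 1) → ℝ≥0∞) → ℝ≥0∞} (hF : Measurable F) :
    ∫⁻ w, F w ∂nuStar G α m = ∫⁻ x, ∫⁻ w, F (fun i => (Fin.cons x w : Fin (m + 1) → ℝ≥0) i)
      ∂pathKernel (tailKernel G (Measure.dirac 0)) m x ∂nuAlpha α := by
  have hcoe : Measurable fun p : ℝ≥0 × (Fin m → ℝ≥0) =>
      fun i => ((Fin.cons p.1 p.2 : Fin (m + 1) → ℝ≥0) i : ℝ≥0∞) :=
    measurable_pi_lambda _ fun i => measurable_coe_nnreal_ennreal.comp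
      ((measurable_pi_apply i).comp (measurable_cons m))
  rw [nuStar, lintegral_map hF hcoe]
  exact Measure.lintegral_compProd (hF.comp hcoe)

theorem lintegral_val_nuStar (G : Measure ℝ≥0) [IsProbabilityMeasure G] (α : ℝ) {m : ℕ}
    (f : PathFun (m + 1)) :
    ∫⁻ w, (f w : ℝ≥0∞) ∂nuStar G α m = ∫⁻ x, ∫⁻ w, (f.tail x).val w
      ∂pathKernel (tailKernel G (Measure.dirac 0)) m x ∂nuAlpha α := by
  simp_rw [← PathFun.val_cons]
  exact lintegral_nuStar G α m (measurable_coe_nnreal_ennreal.comp f.continuous.measurable)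

theorem exists_lt_of_isCompact {E : Type*} [TopologicalSpace E] {A : Set E} (hA : IsCompact A)
    {φ : E → ℝ≥0∞} (hφ : Continuous φ) (hAφ : ∀ x ∈ A, 0 < φ x) :
    ∃ δ : ℝ≥0, 0 < δ ∧ ∀ x ∈ A, (δ : ℝ≥0∞) < φ x := by
  rcases A.eq_empty_or_nonempty with h | h
  · exact ⟨1, one_pos, by simp [h]⟩
  · obtain ⟨z, hz, hmin⟩ := hA.exists_isMinOn h hφ.continuousOn
    obtain ⟨δ, hδ, hδz⟩ := ENNReal.lt_iff_exists_nnreal_btwn.1 (hAφ z hz)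
    exact ⟨δ, ENNReal.coe_pos.1 hδ, fun x hx => hδz.trans_le (hmin hx)⟩

/-- On a compact subset of the cone the first coordinate exceeds some `δ > 0`. The path kernel has
mass one, so the measure is at most `ν_α(δ,∞)`. -/
theorem nuStar_lt_top (G : Measure ℝ≥0) [IsProbabilityMeasure G] {α : ℝ} (hα : 0 < α) {m : ℕ}
    {A : Set (Fin (m + 1) → ℝ≥0∞)} (hAS : A ⊆ coneE m) (hA : IsCompact A) :
    nuStar G α m A < ∞ := by
  obtain ⟨δ, hδ, hδA⟩ := exists_lt_of_isCompact hA (continuous_apply 0) hAS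
  have hB : MeasurableSet {w : Fin (m + 1) → ℝ≥0∞ | (δ : ℝ≥0∞) < w 0} :=
    measurableSet_lt measurable_const (measurable_pi_apply 0)
  refine (measure_mono (show A ⊆ {w | (δ : ℝ≥0∞) < w 0} from hδA)).trans_lt ?_
  rw [← lintegral_indicator_one hB, lintegral_nuStar G α m (measurable_one.indicator hB)]
  have h : ∀ (x : ℝ≥0) (w : Fin m → ℝ≥0),
      indicator {w : Fin (m + 1) → ℝ≥0∞ | (δ : ℝ≥0∞) < w 0} (1 : (Fin (m + 1) → ℝ≥0∞) → ℝ≥0∞)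
        (fun i => (Fin.cons x w : Fin (m + 1) → ℝ≥0) i) = (Ioi δ).indicator 1 x := by
    intro x w
    simp [indicator_apply]
  simp only [h, lintegral_const, measure_univ, mul_one]
  rw [lintegral_indicator_one measurableSet_Ioi, nuAlpha_Ioi hα hδ]
  exact ENNReal.ofReal_lt_top

theorem lintegral_scaledFdd {Ω : Type*} [MeasurableSpace Ω] (P : Measure Ω) {X : ℕ → Ω → ℝ≥0}
    (hX : ∀ n, Measurable (X n)) {m : ℕ} (t s : ℝ≥0) (f : PathFun (m + 1)) :
    ∫⁻ w, (f w : ℝ≥0∞) ∂(t • scaledFdd P X m s) = t * ∫⁻ ω, f.val (fun i => X i ω / s) ∂P := by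
  have hf : Measurable fun w => (f w : ℝ≥0∞) :=
    measurable_coe_nnreal_ennreal.comp f.continuous.measurable
  have hXs : Measurable fun ω (i : Fin (m + 1)) => ((X i ω / s : ℝ≥0) : ℝ≥0∞) :=
    measurable_pi_lambda _ fun i => (measurable_scale s).comp (hX i)
  rw [scaledFdd, lintegral_smul_measure, lintegral_map hf hXs]
  rfl

variable {Ω : Type*} [MeasurableSpace Ω] {P : Measure Ω} [IsProbabilityMeasure P]
  {K : Kernel ℝ≥0 ℝ≥0} [IsMarkovKernel K] {X : ℕ → Ω → ℝ≥0}

theorem IsMarkovChain.lintegral_div_eq (hX : IsMarkovChain X K P) (m : ℕ) {s : ℝ≥0} (hs : 0 < s)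
    {F : (Fin (m + 1) → ℝ≥0) → ℝ≥0∞} (hF : Measurable F) :
    ∫⁻ ω, F (fun i => X i ω / s) ∂P
      = ∫⁻ x, ∫⁻ w, F (Fin.cons (x / s) w) ∂pathKernel (scaledKernel K s) m (x / s)
          ∂P.map (X 0) := by
  refine (hX.lintegral_eq m (hF.comp (measurable_path_div s))).trans (lintegral_congr fun x => ?_)
  refine Eq.trans ?_ (lintegral_pathKernel_scaledKernel K hs m (x / s)
    (hF.comp (measurable_cons_right (x / s)))).symm
  rw [mul_div_cancel₀ _ hs.ne']
  refine lintegral_congr fun w => ?_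
  simp only [Function.comp_apply]
  rw [cons_div]

/-- `killPath` also kills a low starting point, but `killedKernel` does not. The assumptions on `F`
make both sides vanish for such starts. -/
theorem IsMarkovChain.lintegral_killPath_eq (hX : IsMarkovChain X K P) (m : ℕ) {s : ℝ≥0}
    (hs : 0 < s) (c : ℝ≥0) {F : (Fin (m + 1) → ℝ≥0) → ℝ≥0∞} (hF : Measurable F) (hF0 : F 0 = 0)
    (hFc : ∀ x ≤ c, ∀ w : Fin m → ℝ≥0, F (Fin.cons x w) = 0) :
    ∫⁻ ω, F (fun i => killPath (s * c) (fun j : Fin (m + 1) => X j ω) i / s) ∂P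
      = ∫⁻ x, ∫⁻ w, F (Fin.cons (x / s) w)
          ∂pathKernel (killedKernel (scaledKernel K s) c) m (x / s) ∂P.map (X 0) := by
  refine (hX.lintegral_eq m (hF.comp ((measurable_path_div s).comp
    (measurable_killPath (s * c) _)))).trans (lintegral_congr fun x => ?_)
  simp only [Function.comp_apply]
  rcases le_or_gt x (s * c) with hx | hx
  · have hx' : x / s ≤ c := by rwa [div_le_iff₀' hs]
    simp only [killPath_cons_of_le hx, hFc _ hx', lintegral_const, zero_mul]
    have : (fun i : Fin (m + 1) => (0 : Fin (m + 1) → ℝ≥0) i / s) = 0 := by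
      ext i
      simp
    rw [this, hF0, zero_mul]
  · have hx' : c < x / s := by rwa [lt_div_iff₀' hs]
    refine Eq.trans ?_ (lintegral_pathKernel_killedKernel K hs c m (bot_le.trans_lt hx')
      (hF.comp (measurable_cons_right (x / s)))).symm
    rw [mul_div_cancel₀ _ hs.ne']
    refine lintegral_congr fun w => ?_
    simp only [Function.comp_apply]
    rw [killPath_cons_of_lt hx, cons_div]

variable {G H : Measure ℝ≥0} [IsProbabilityMeasure G] {α : ℝ} {b : ℝ≥0 → ℝ≥0} {Z : Filter ℝ≥0}
  {Q : ℝ≥0 → Kernel ℝ≥0 ℝ≥0} [∀ s, IsMarkovKernel (Q s)]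

/-- Path expectations converge continuously at every positive starting point and vanish for starts
at most `δ`, which is what integration against the scaled initial law requires. -/
theorem tendsto_lintegral_pathExpectCons (hα : 0 < α) (hb : Tendsto b atTop atTop)
    (hH : VagueTendstoOn posCone atTop
      (fun t : ℝ≥0 => t • H.map fun x : ℝ≥0 => ((x / b t : ℝ≥0) : ℝ≥0∞)) (nuAlphaE α))
    (hN : IsNhdsSystem (nhdsWithZero Z)) (hQ : TailLimit Q G Z) {S : ∀ m, Set (PathFun m)}
    (hS : ∀ m, ∀ f ∈ S (m + 1), ∀ x, PathFun.tail f x ∈ S m)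
    (hzero : ∀ m, ∀ f₀ ∈ S (m + 1), Tendsto (pathExpectCons Q m)
      (atTop ×ˢ Z ×ˢ 𝓝[S (m + 1)] f₀) (𝓝 ((f₀ : PathFun (m + 1)) 0 : ℝ≥0∞)))
    {m : ℕ} {f : PathFun (m + 1)} (hf : f ∈ S (m + 1)) {δ : ℝ≥0} (hδ : 0 < δ)
    (hfδ : ∀ w, w 0 ≤ (δ : ℝ≥0∞) → f w = 0) :
    Tendsto (fun t => t * ∫⁻ x, pathExpectCons Q m (b t, x / b t, f) ∂H) atTop
      (𝓝 (∫⁻ w, (f w : ℝ≥0∞) ∂nuStar G α m)) := by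
  obtain ⟨C, hC⟩ := f.exists_eventually_val_le
  have hfδ' : ∀ x ≤ δ, ∀ w : Fin m → ℝ≥0, (f.tail x).val w = 0 := by
    intro x hx w
    rw [← PathFun.val_cons, PathFun.val, hfδ _ (ENNReal.coe_le_coe.2 hx), ENNReal.coe_zero]
  have hgm : ∀ s, Measurable fun x => pathExpectCons Q m (s, x, f) := fun s =>
    measurable_lintegral_tail (Q s) f
  have key := tendsto_lintegral_initialMeasure hα hb hH
    (g := fun s x => pathExpectCons Q m (s, x, f)) hgm
    (measurable_lintegral_tail (tailKernel G (Measure.dirac 0)) f) hδ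
    (fun s x => lintegral_tail_le (Q s) hC.self_of_nhds x)
    (fun x => lintegral_tail_le _ hC.self_of_nhds x)
    (fun s x hx => by simp [pathExpectCons, pathExpect, hfδ' x hx])
    (fun x hx => by simp [hfδ' x hx]) ?_
  · rw [lintegral_val_nuStar]
    refine key.congr fun t => ?_
    exact lintegral_initialMeasure H t (b t) (hgm (b t))
  · intro x₀ hx₀
    -- The outermost test function is fixed; membership in the class keeps the constant family
    -- inside the filter.
    have hconst : Tendsto (fun p : ℝ≥0 × ℝ≥0 => (p.1, p.2, f)) (atTop ×ˢ 𝓝 x₀)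
        (atTop ×ˢ 𝓝 x₀ ×ˢ 𝓝[S (m + 1)] f) :=
      tendsto_fst.prodMk (tendsto_snd.prodMk
        ((tendsto_pure.2 (Eventually.of_forall fun _ => rfl)).mono_right (pure_le_nhdsWithin hf)))
    exact ((tendsto_pathExpect hN hQ hS hzero m (hS m f hf x₀) hx₀).comp
      (tendsto_tail (hS m) f x₀ le_rfl)).comp hconst

/-- The indicator that a path has not reached `0` at its last time. -/
def aliveLast {m : ℕ} (v : Fin (m + 1) → ℝ≥0) : ℝ≥0∞ := if v (Fin.last m) = 0 then 0 else 1

theorem measurable_aliveLast {m : ℕ} :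
    Measurable (aliveLast : (Fin (m + 1) → ℝ≥0) → ℝ≥0∞) :=
  Measurable.ite (measurable_pi_apply _ (measurableSet_singleton 0)) measurable_const
    measurable_const

theorem aliveLast_le_one {m : ℕ} (v : Fin (m + 1) → ℝ≥0) : aliveLast v ≤ 1 := by
  unfold aliveLast
  split_ifs <;> simp

/-- As `0` is absorbing, being alive at the last time means never having been killed. By induction
the survival probability from any positive state has the same limit, and averaging over one step
contributes the factor `1 - G {0}`. The limiting integrand jumps at `0`, which is harmless because
`0` is isolated. -/
theorem tendsto_lintegral_aliveLast (hQ : TailLimit Q G (pure 0))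
    (hQ0 : ∀ s, Q s 0 = Measure.dirac 0) (m : ℕ) {x₀ : ℝ≥0} (hx₀ : 0 < x₀) :
    Tendsto (fun p : ℝ≥0 × ℝ≥0 => ∫⁻ w, aliveLast (Fin.cons p.2 w : Fin (m + 1) → ℝ≥0)
      ∂pathKernel (Q p.1) m p.2) (atTop ×ˢ 𝓝 x₀) (𝓝 ((1 - G {0}) ^ m)) := by
  induction m generalizing x₀ with
  | zero =>
    refine tendsto_const_nhds.congr' ?_
    filter_upwards [tendsto_snd.eventually (lt_mem_nhds hx₀)] with p hp
    rw [lintegral_pathKernel_zero]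
    simp [aliveLast, hp.ne']
  | succ m ih =>
    set f₀ : ℝ≥0 → ℝ≥0∞ := indicator {0}ᶜ fun _ => (1 - G {0}) ^ m with hf₀
    have hint : ∫⁻ z, f₀ z ∂G.map (fun z => x₀ * z) = (1 - G {0}) ^ (m + 1) := by
      have : IsProbabilityMeasure (G.map fun z => x₀ * z) :=
        Measure.isProbabilityMeasure_map (by fun_prop)
      rw [hf₀, lintegral_indicator_const (measurableSet_singleton 0).compl,
        prob_compl_eq_one_sub (measurableSet_singleton 0), map_mul_left_singleton_zero G hx₀,
        pow_succ]
    have : IsProbabilityMeasure (G.map fun z => x₀ * z) :=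
      Measure.isProbabilityMeasure_map (by fun_prop)
    rw [← hint]
    have key := tendsto_lintegral_of_isNhdsSystem (l := atTop ×ˢ 𝓝 x₀)
      isNhdsSystem_nhdsWithZero_pure (hQ x₀ hx₀) (μ := fun p : ℝ≥0 × ℝ≥0 => Q p.1 p.2)
      (f := fun p z => ∫⁻ w, aliveLast (Fin.cons z w : Fin (m + 1) → ℝ≥0) ∂pathKernel (Q p.1) m z)
      (f₀ := f₀) (h := fun _ => 1)
      (fun p => measurable_lintegral_pathKernel (Q p.1) m measurable_aliveLast)
      (measurable_const.indicator (measurableSet_singleton 0).compl) measurable_const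
      (Eventually.of_forall fun p z => ?_) (fun z => ?_) (fun _ => ENNReal.one_ne_top)
      (fun _ => tendsto_const_nhds) (by simp) (by simp)
      (Eventually.of_forall fun z => ?_)
    · refine key.congr fun p => ?_
      have hm : Measurable fun w : Fin (m + 1) → ℝ≥0 =>
          aliveLast (Fin.cons p.2 w : Fin (m + 2) → ℝ≥0) :=
        measurable_aliveLast.comp (measurable_cons_right p.2)
      rw [lintegral_pathKernel_succ (Q p.1) m p.2 hm]
      refine lintegral_congr fun z => lintegral_congr fun w => ?_
      unfold aliveLast
      rw [Fin.cons_last]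
    · calc _ ≤ ∫⁻ _, 1 ∂pathKernel (Q p.1) m z := lintegral_mono fun w => aliveLast_le_one _
        _ = 1 := by simp
    · refine indicator_le' (g := fun _ => (1 : ℝ≥0∞)) (fun _ _ => ?_) (fun _ _ => bot_le) z
      exact pow_le_one₀ bot_le tsub_le_self
    · rcases eq_or_ne z 0 with rfl | hz
      · rw [nhdsWithZero_zero]
        have h0 : f₀ 0 = 0 := indicator_of_notMem (by simp) _
        rw [h0]
        refine tendsto_const_nhds.congr' ?_
        filter_upwards [tendsto_snd.eventually (eventually_pure.2 (rfl : (0 : ℝ≥0) = 0) :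
          ∀ᶠ z in pure (0 : ℝ≥0), z = 0)] with q hq
        rw [hq, lintegral_pathKernel_of_absorbing (hQ0 q.1.1) m
          (F := fun w => aliveLast (Fin.cons 0 w : Fin (m + 1) → ℝ≥0))
          (measurable_aliveLast.comp (measurable_cons_right 0))]
        have : (Fin.cons 0 (0 : Fin m → ℝ≥0) : Fin (m + 1) → ℝ≥0) = 0 := by
          ext i
          refine Fin.cases ?_ (fun j => ?_) i <;> simp
        simp [this, aliveLast]
      · have hz' := pos_iff_ne_zero.2 hz
        rw [nhdsWithZero_of_pos _ hz']
        have h0 : f₀ z = (1 - G {0}) ^ m := indicator_of_mem (by simpa using hz) _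
        rw [h0]
        exact (ih hz').comp ((tendsto_fst.comp tendsto_fst).prodMk tendsto_snd)

end Survival

/-! ### Behaviour at zero, and convergence for the chain itself -/

section FiniteDimensional

theorem isOpen_coneE (m : ℕ) : IsOpen (coneE m) :=
  isOpen_lt continuous_const (continuous_apply 0)

theorem isOpen_coneRestr (m : ℕ) : IsOpen (coneRestr m) := by
  simp only [coneRestr, ofPred_forall]
  exact isOpen_iInter_of_finite fun i => isOpen_lt continuous_const (continuous_apply _)

theorem tendsto_pathFun_zero {m : ℕ} {l : Filter ℝ≥0} (Y : Filter ℝ≥0) (S : Set (PathFun m))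
    (f₀ : PathFun m) :
    Tendsto (fun p : ℝ≥0 × ℝ≥0 × PathFun m => (p.2.2 0 : ℝ≥0∞)) (l ×ˢ Y ×ˢ 𝓝[S] f₀)
      (𝓝 (f₀ 0 : ℝ≥0∞)) :=
  (((ENNReal.continuous_coe.comp (ContinuousEvalConst.continuous_eval_const (0 : Fin m → ℝ≥0∞))
    ).tendsto f₀).mono_left nhdsWithin_le_nhds).comp (tendsto_snd.comp tendsto_snd)

theorem tendsto_pathExpectCons_pure_of_absorbing {Q : ℝ≥0 → Kernel ℝ≥0 ℝ≥0}
    [∀ s, IsMarkovKernel (Q s)] (hQ : ∀ s, Q s 0 = Measure.dirac 0) {m : ℕ}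
    (S : Set (PathFun (m + 1))) (f₀ : PathFun (m + 1)) :
    Tendsto (pathExpectCons Q m) (atTop ×ˢ pure 0 ×ˢ 𝓝[S] f₀) (𝓝 (f₀ 0 : ℝ≥0∞)) := by
  refine (tendsto_pathFun_zero (pure 0) S f₀).congr' ?_
  have h0 : ∀ᶠ z in pure (0 : ℝ≥0), z = 0 := eventually_pure.2 rfl
  filter_upwards [(tendsto_fst.comp tendsto_snd).eventually h0] with p hp
  have hp' : p.2.1 = 0 := hp
  rw [pathExpectCons, pathExpect, hp', lintegral_pathKernel_of_absorbing (hQ p.1) m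
    (PathFun.measurable_val _), PathFun.tail_val_zero]

/-- From exactly `0` the unscaled path law does not depend on `s`, so dividing by `s → ∞` sends the
path to zero and dominated convergence applies. No condition on the kernel at `0` is needed. -/
theorem tendsto_pathExpectCons_pure_scaledKernel (K : Kernel ℝ≥0 ℝ≥0) [IsMarkovKernel K] {m : ℕ}
    (S : Set (PathFun (m + 1))) (f₀ : PathFun (m + 1)) :
    Tendsto (pathExpectCons (scaledKernel K) m) (atTop ×ˢ pure 0 ×ˢ 𝓝[S] f₀)
      (𝓝 (f₀ 0 : ℝ≥0∞)) := by
  obtain ⟨C, hC⟩ := f₀.exists_eventually_val_le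
  have hconst : ∫⁻ _, (f₀ 0 : ℝ≥0∞) ∂pathKernel K m 0 = f₀ 0 := by simp
  rw [← hconst]
  have key := tendsto_lintegral_filter_of_dominated_convergence (μ := pathKernel K m 0)
    (l := atTop ×ˢ pure (0 : ℝ≥0) ×ˢ 𝓝[S] f₀)
    (F := fun p w => (p.2.2.tail 0).val fun i => w i / p.1) (f := fun _ => (f₀ 0 : ℝ≥0∞))
    (fun _ => C)
    (Eventually.of_forall fun p => (PathFun.measurable_val _).comp (measurable_path_div p.1))
    ?_ (by simp) (Eventually.of_forall fun w => ?_)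
  · refine key.congr' ?_
    have h0 : ∀ᶠ z in pure (0 : ℝ≥0), z = 0 := eventually_pure.2 rfl
    filter_upwards [(tendsto_fst.comp tendsto_snd).eventually h0,
      tendsto_fst.eventually (eventually_gt_atTop 0)] with p hp hp1
    have hp' : p.2.1 = 0 := hp
    rw [pathExpectCons, pathExpect, hp',
      lintegral_pathKernel_scaledKernel K hp1 m 0 (PathFun.measurable_val _), mul_zero]
  · filter_upwards [(tendsto_snd.comp tendsto_snd).eventually (hC.filter_mono nhdsWithin_le_nhds)]
      with p hp
    refine Eventually.of_forall fun w => ?_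
    rw [← PathFun.val_cons]
    exact hp _
  · have hdiv : ∀ i, Tendsto (fun s : ℝ≥0 => w i / s) atTop (𝓝 0) := fun i => by
      rw [← NNReal.tendsto_coe]
      simp only [NNReal.coe_div]
      exact tendsto_const_nhds.div_atTop (NNReal.tendsto_coe_atTop.2 tendsto_id)
    set v : ℝ≥0 → Fin (m + 1) → ℝ≥0∞ := fun s i =>
      ((Fin.cons 0 (fun i => w i / s) : Fin (m + 1) → ℝ≥0) i : ℝ≥0∞) with hv
    have hw : Tendsto v atTop (𝓝 0) := by
      refine tendsto_pi_nhds.2 fun i => ?_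
      refine Fin.cases ?_ (fun j => ?_) i
      · exact tendsto_const_nhds
      · exact ENNReal.tendsto_coe.2 (hdiv j)
    have hf : Tendsto (fun p : ℝ≥0 × ℝ≥0 × PathFun (m + 1) => p.2.2)
        (atTop ×ˢ pure 0 ×ˢ 𝓝[S] f₀) (𝓝 f₀) :=
      (tendsto_snd.comp tendsto_snd).mono_right nhdsWithin_le_nhds
    have hev : Continuous fun q : PathFun (m + 1) × (Fin (m + 1) → ℝ≥0∞) => (q.1 q.2 : ℝ≥0∞) :=
      ENNReal.continuous_coe.comp ContinuousEval.continuous_eval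
    have hpair := hf.prodMk_nhds (hw.comp tendsto_fst)
    refine ((hev.tendsto (f₀, 0)).comp hpair).congr fun p => ?_
    rw [← PathFun.val_cons]
    rfl

/-- The regularity condition, stated along functions, is continuous convergence at `0`; the
portmanteau theorem turns it into a bound on open sets. -/
theorem scaledKernel_zero_le_liminf {K : Kernel ℝ≥0 ℝ≥0} [IsMarkovKernel K]
    (hK : RegularityCondition K) {U : Set ℝ≥0} (hU : IsOpen U) :
    Measure.dirac 0 U
      ≤ liminf (fun p : ℝ≥0 × ℝ≥0 => scaledKernel K p.1 p.2 U) (atTop ×ˢ 𝓝 0) := by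
  have h := ProbabilityMeasure.le_liminf_measure_open_of_tendsto
    (tendsto_of_forall_comp_tendsto (F := fun t u => scaledLaw (K (t * u)) t) hK)
    (ENNReal.isOpenEmbedding_coe.isOpenMap U hU)
  simp only [scaledLaw_image_coe _ _ hU] at h
  have h1 : (Measure.dirac (0 : ℝ≥0)).map (fun x => x / 1) U = Measure.dirac 0 U := by simp
  rw [h1] at h
  refine h.trans_eq (liminf_congr (Eventually.of_forall fun p => ?_))
  rw [scaledKernel, Kernel.map_apply _ (by fun_prop), Kernel.comap_apply]

theorem tendsto_pathExpectCons_of_regularityCondition {K : Kernel ℝ≥0 ℝ≥0} [IsMarkovKernel K]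
    (hK : RegularityCondition K) {m : ℕ} (f₀ : PathFun (m + 1)) :
    Tendsto (pathExpectCons (scaledKernel K) m) (atTop ×ˢ 𝓝 0 ×ˢ 𝓝[univ] f₀)
      (𝓝 (f₀ 0 : ℝ≥0∞)) := by
  rw [← PathFun.tail_val_zero]
  exact (tendsto_pathExpect_nhds_zero (fun U hU => scaledKernel_zero_le_liminf hK hU) m
    (f₀.tail 0)).comp (tendsto_tail (fun _ _ _ => mem_univ _) f₀ 0 le_rfl)

/-- Functions vanishing as soon as one of the points, except possibly the last, is at most `δ`. -/
def vanishingPathFun (δ : ℝ≥0) (m : ℕ) : Set (PathFun m) :=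
  {f | ∀ w : Fin m → ℝ≥0∞, ∀ i : Fin m, (i : ℕ) + 1 < m → w i ≤ δ → f w = 0}

theorem tail_mem_vanishingPathFun {δ : ℝ≥0} {m : ℕ} {f : PathFun (m + 1)}
    (hf : f ∈ vanishingPathFun δ (m + 1)) (x : ℝ≥0) : f.tail x ∈ vanishingPathFun δ m := by
  intro w i hi hw
  refine hf (Fin.cons (x : ℝ≥0∞) w) i.succ ?_ ?_
  · simpa using hi
  · simpa using hw

/-- If another point follows, every function of the class vanishes for starts at most `δ`. If the
start is itself the final point, no kernel is involved and continuity suffices. -/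
theorem tendsto_pathExpectCons_vanishingPathFun (Q : ℝ≥0 → Kernel ℝ≥0 ℝ≥0)
    {δ : ℝ≥0} (hδ : 0 < δ) {m : ℕ} {f₀ : PathFun (m + 1)}
    (hf₀ : f₀ ∈ vanishingPathFun δ (m + 1)) :
    Tendsto (pathExpectCons Q m) (atTop ×ˢ 𝓝 0 ×ˢ 𝓝[vanishingPathFun δ (m + 1)] f₀)
      (𝓝 (f₀ 0 : ℝ≥0∞)) := by
  rcases m with _ | m
  · have h := (tendsto_pathExpect_zero Q (𝓝 0) univ (f₀.tail 0)).comp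
      (tendsto_tail (S := vanishingPathFun δ 1) (fun _ _ _ => mem_univ _) f₀ 0 le_rfl)
    rwa [Subsingleton.elim (Fin.elim0 : Fin 0 → ℝ≥0) 0, PathFun.tail_val_zero] at h
  · have h0 : f₀ 0 = 0 := hf₀ 0 0 (by simp) bot_le
    rw [h0, ENNReal.coe_zero]
    refine tendsto_const_nhds.congr' ?_
    filter_upwards [(tendsto_fst.comp tendsto_snd).eventually (ge_mem_nhds hδ),
      (tendsto_snd.comp tendsto_snd).eventually self_mem_nhdsWithin] with p hp hpS
    have hpS' : p.2.2 ∈ vanishingPathFun δ (m + 2) := hpS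
    have hz : ∀ w, (p.2.2.tail p.2.1).val w = 0 := fun w => by
      rw [← PathFun.val_cons, PathFun.val, hpS' _ 0 (by simp) (ENNReal.coe_le_coe.2 hp),
        ENNReal.coe_zero]
    simp [pathExpectCons, pathExpect, hz]

variable {Ω : Type*} [MeasurableSpace Ω] {P : Measure Ω} [IsProbabilityMeasure P]
  {K : Kernel ℝ≥0 ℝ≥0} [IsMarkovKernel K] {X : ℕ → Ω → ℝ≥0} {G : Measure ℝ≥0}
  [IsProbabilityMeasure G] {α : ℝ} {b : ℝ≥0 → ℝ≥0} {y : ℝ≥0 → ℝ≥0}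

theorem measurable_extremalComponent (hX : ∀ n, Measurable (X n)) (y : ℝ≥0 → ℝ≥0) (t : ℝ≥0)
    (n : ℕ) : Measurable (extremalComponent X y t n) := by
  have h : extremalComponent X y t n
      = fun ω => killPath (t * y t) (fun j : Fin (n + 1) => X j ω) (Fin.last n) :=
    funext fun ω => extremalComponent_eq_killPath X y t (Fin.last n) ω
  rw [h]
  exact (measurable_pi_apply (Fin.last n)).comp ((measurable_killPath (t * y t) (n + 1)).comp
    (measurable_pi_lambda _ fun i => hX i))

theorem isFiniteMeasure_smul_scaledFdd (P : Measure Ω) [IsProbabilityMeasure P] (X : ℕ → Ω → ℝ≥0)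
    (m : ℕ) (t s : ℝ≥0) : IsFiniteMeasure (t • scaledFdd P X m s) := by
  unfold scaledFdd
  infer_instance

theorem IsMarkovChain.tendsto_lintegral_scaledFdd (hX : IsMarkovChain X K P)
    (hb : Tendsto b atTop atTop) {m : ℕ} {f : PathFun (m + 1)} {a : ℝ≥0∞}
    (h : Tendsto (fun t => t * ∫⁻ x, pathExpectCons (scaledKernel K) m (b t, x / b t, f)
      ∂P.map (X 0)) atTop (𝓝 a)) :
    Tendsto (fun t : ℝ≥0 => ∫⁻ w, (f w : ℝ≥0∞) ∂(t • scaledFdd P X m (b t))) atTop (𝓝 a) := by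
  refine h.congr' ?_
  filter_upwards [hb.eventually_gt_atTop 0] with t ht
  rw [lintegral_scaledFdd P hX.measurable, hX.lintegral_div_eq m ht f.measurable_val]
  simp_rw [PathFun.val_cons]
  rfl

theorem IsMarkovChain.tendsto_lintegral_scaledFdd_extremalComponent (hX : IsMarkovChain X K P)
    (hb : Tendsto b atTop atTop) (hy : Tendsto y atTop (𝓝 0)) {m : ℕ} {f : PathFun (m + 1)}
    {δ : ℝ≥0} (hδ : 0 < δ) (hfδ : ∀ w, w 0 ≤ (δ : ℝ≥0∞) → f w = 0) {a : ℝ≥0∞}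
    (h : Tendsto (fun t => t * ∫⁻ x, pathExpectCons
      (fun s => killedKernel (scaledKernel K s) (y s)) m (b t, x / b t, f)
      ∂P.map (X 0)) atTop (𝓝 a)) :
    Tendsto (fun t : ℝ≥0 => ∫⁻ w, (f w : ℝ≥0∞)
      ∂(t • scaledFdd P (extremalComponent X y (b t)) m (b t))) atTop (𝓝 a) := by
  refine h.congr' ?_
  -- Once `y (b t) ≤ δ`, the test function ignores starts below the boundary, as
  -- `lintegral_killPath_eq` requires.
  filter_upwards [hb.eventually_gt_atTop 0, (hy.comp hb).eventually (ge_mem_nhds hδ)]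
    with t ht hyt
  rw [lintegral_scaledFdd P (measurable_extremalComponent hX.measurable y (b t))]
  simp_rw [extremalComponent_eq_killPath X y (b t)]
  rw [hX.lintegral_killPath_eq m ht (y (b t)) f.measurable_val]
  · simp_rw [PathFun.val_cons]
    rfl
  · rw [PathFun.val, hfδ _ (by simp), ENNReal.coe_zero]
  · intro x hx w
    rw [PathFun.val, hfδ _ (ENNReal.coe_le_coe.2 (hx.trans hyt)), ENNReal.coe_zero]

/-- The event says that the points at times `0, …, m` all exceed the boundary, that is, that the
killed path is nonzero at time `m`. Thus `m + 1` in the event corresponds to `m` steps. -/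
theorem IsMarkovChain.lintegral_survival (hX : IsMarkovChain X K P) (m : ℕ) {s : ℝ≥0} (hs : 0 < s)
    {f : C(ℝ≥0∞, ℝ≥0)} (hf : ∀ x ≤ (y s : ℝ≥0∞), f x = 0) :
    ∫⁻ ω in {ω | ((m + 1 : ℕ) : ℕ∞) ≤ tau X y s ω}, (f ((X 0 ω / s : ℝ≥0) : ℝ≥0∞) : ℝ≥0∞) ∂P
      = ∫⁻ x, f ((x / s : ℝ≥0) : ℝ≥0∞) * ∫⁻ w, aliveLast (Fin.cons (x / s) w : Fin (m + 1) → ℝ≥0)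
        ∂pathKernel (killedKernel (scaledKernel K s) (y s)) m (x / s) ∂P.map (X 0) := by
  have hfm : Measurable fun x : ℝ≥0 => (f (x : ℝ≥0∞) : ℝ≥0∞) := measurable_coe_nnreal_ennreal.comp
    (f.continuous.measurable.comp measurable_coe_nnreal_ennreal)
  have hset : {ω | ((m + 1 : ℕ) : ℕ∞) ≤ tau X y s ω} = {ω | ∀ j ≤ m, s * y s < X j ω} := by
    ext ω
    rw [mem_ofPred_eq, mem_ofPred_eq, ← lt_tau_iff, Nat.cast_add, Nat.cast_one]
    exact ENat.add_one_le_iff (ENat.natCast_ne_top m)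
  have hmeas : MeasurableSet {ω | ∀ j ≤ m, s * y s < X j ω} := by
    simp only [ofPred_forall]
    exact MeasurableSet.iInter fun j => MeasurableSet.iInter fun _ =>
      measurableSet_lt measurable_const (hX.measurable j)
  set F : (Fin (m + 1) → ℝ≥0) → ℝ≥0∞ := fun v => f (v 0 : ℝ≥0∞) * aliveLast v with hF
  have hFm : Measurable F := (hfm.comp (measurable_pi_apply 0)).mul measurable_aliveLast
  have hkill := hX.lintegral_killPath_eq m hs (y s) hFm
    (by simp [hF, aliveLast]) (fun x hx w => by simp [hF, hf x (ENNReal.coe_le_coe.2 hx)])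
  rw [hset, ← lintegral_indicator hmeas]
  refine Eq.trans (lintegral_congr fun ω => ?_) (hkill.trans (lintegral_congr fun x => ?_))
  · by_cases hω : ω ∈ {ω | ∀ j ≤ m, s * y s < X j ω}
    · rw [indicator_of_mem hω]
      have h1 : killPath (s * y s) (fun j : Fin (m + 1) => X j ω) = fun j : Fin (m + 1) => X j ω :=
        funext fun i => if_pos fun j (_ : j ≤ i) => hω j (Nat.lt_succ_iff.1 j.2)
      have h2 : X m ω / s ≠ 0 :=
        (div_pos (bot_le.trans_lt (hω m le_rfl)) hs).ne'
      simp only [hF, h1, aliveLast, Fin.val_last, if_neg h2, mul_one]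
      rfl
    · rw [indicator_of_notMem hω]
      have h1 : killPath (s * y s) (fun j : Fin (m + 1) => X j ω) (Fin.last m) = 0 := by
        refine if_neg fun h => hω fun j hj => ?_
        exact h ⟨j, Nat.lt_succ_iff.2 hj⟩ (Fin.le_last _)
      simp [hF, aliveLast, h1]
  · simp only [hF, Fin.cons_zero]
    exact lintegral_const_mul _ (measurable_aliveLast.comp (measurable_cons_right _))

theorem IsMarkovChain.tendsto_lintegral_survival (hX : IsMarkovChain X K P) (hα : 0 < α)
    (hb : Tendsto b atTop atTop)
    (hH : VagueTendstoOn posCone atTop (fun t : ℝ≥0 => t • (P.map (X 0)).map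
      fun x : ℝ≥0 => ((x / b t : ℝ≥0) : ℝ≥0∞)) (nuAlphaE α))
    (hK : InDomainOfAttraction K G) (hy : IsUniformExtremalBoundary K G y) (m : ℕ)
    {f : C(ℝ≥0∞, ℝ≥0)} {δ : ℝ≥0} (hδ : 0 < δ) (hf : ∀ x ≤ (δ : ℝ≥0∞), f x = 0) :
    Tendsto (fun t : ℝ≥0 => ∫⁻ x, (f x : ℝ≥0∞)
      ∂(t • (P.restrict {ω | ((m + 1 : ℕ) : ℕ∞) ≤ tau X y (b t) ω}).map
        fun ω => ((X 0 ω / b t : ℝ≥0) : ℝ≥0∞))) atTop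
      (𝓝 (∫⁻ x, (f x : ℝ≥0∞) ∂((1 - G {0}) ^ m • nuAlphaE α))) := by
  have hfm : Measurable fun x => (f x : ℝ≥0∞) :=
    measurable_coe_nnreal_ennreal.comp f.continuous.measurable
  have hfm' : Measurable fun x : ℝ≥0 => (f (x : ℝ≥0∞) : ℝ≥0∞) :=
    hfm.comp measurable_coe_nnreal_ennreal
  obtain ⟨C, hC⟩ := (isCompact_range f.continuous).bddAbove
  have hfC : ∀ x : ℝ≥0, (f (x : ℝ≥0∞) : ℝ≥0∞) ≤ C := fun x =>
    ENNReal.coe_le_coe.2 (hC (mem_range_self _))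
  have hc : (1 - G {0}) ^ m ≤ 1 := pow_le_one₀ bot_le tsub_le_self
  set Q : ℝ≥0 → Kernel ℝ≥0 ℝ≥0 := fun s => killedKernel (scaledKernel K s) (y s) with hQ
  set r : ℝ≥0 → ℝ≥0 → ℝ≥0∞ := fun s x =>
    ∫⁻ w, aliveLast (Fin.cons x w : Fin (m + 1) → ℝ≥0) ∂pathKernel (Q s) m x with hr
  have hrm : ∀ s, Measurable (r s) := fun s =>
    measurable_lintegral_pathKernel (Q s) m measurable_aliveLast
  have hr1 : ∀ s x, r s x ≤ 1 := fun s x => by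
    calc r s x ≤ ∫⁻ _, 1 ∂pathKernel (Q s) m x := lintegral_mono fun w => aliveLast_le_one _
      _ = 1 := by simp
  have hf0 : ∀ x ≤ δ, (f (x : ℝ≥0∞) : ℝ≥0∞) = 0 := fun x hx => by
    rw [hf _ (ENNReal.coe_le_coe.2 hx), ENNReal.coe_zero]
  have key := tendsto_lintegral_initialMeasure hα hb hH
    (g := fun s x => f (x : ℝ≥0∞) * r s x) (g₀ := fun x => f (x : ℝ≥0∞) * (1 - G {0}) ^ m)
    (fun s => hfm'.mul (hrm s)) (hfm'.mul_const _) hδ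
    (fun s x => (mul_le_of_le_one_right bot_le (hr1 s x)).trans (hfC x))
    (fun x => (mul_le_of_le_one_right bot_le hc).trans (hfC x))
    (fun s x hx => by rw [hf0 x hx, zero_mul]) (fun x hx => by rw [hf0 x hx, zero_mul])
    fun x₀ hx₀ => ENNReal.Tendsto.mul
      (((ENNReal.continuous_coe.comp (f.continuous.comp ENNReal.continuous_coe)).tendsto x₀).comp
        tendsto_snd) (Or.inr (ne_top_of_le_ne_top ENNReal.one_ne_top hc))
      (tendsto_lintegral_aliveLast (hy.tailLimit_killedKernel hK)
        (fun s => killedKernel_zero _ _) m hx₀) (Or.inr ENNReal.coe_ne_top)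
  rw [lintegral_smul_measure, nuAlphaE, lintegral_map hfm measurable_coe_nnreal_ennreal,
    smul_eq_mul, mul_comm, ← lintegral_mul_const _ hfm']
  refine key.congr' ?_
  filter_upwards [hb.eventually_gt_atTop 0,
    (hy.tendsto_zero.comp hb).eventually (ge_mem_nhds hδ)] with t ht hyt
  have hXs : Measurable fun ω => ((X 0 ω / b t : ℝ≥0) : ℝ≥0∞) :=
    (measurable_scale (b t)).comp (hX.measurable 0)
  rw [lintegral_smul_measure, lintegral_map hfm hXs,
    hX.lintegral_survival m ht fun x hx => hf x (hx.trans (ENNReal.coe_le_coe.2 hyt))]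
  exact lintegral_initialMeasure _ t (b t) (hfm'.mul (hrm (b t)))

theorem nuAlphaE_lt_top (hα : 0 < α) {A : Set ℝ≥0∞} (hAS : A ⊆ posCone) (hA : IsCompact A) :
    nuAlphaE α A < ∞ := by
  obtain ⟨δ, hδ, hδA⟩ := exists_lt_of_isCompact hA continuous_id hAS
  refine (measure_mono (show A ⊆ Ioi (δ : ℝ≥0∞) from hδA)).trans_lt ?_
  have hpre : (fun x : ℝ≥0 => (x : ℝ≥0∞)) ⁻¹' Ioi (δ : ℝ≥0∞) = Ioi δ := by
    ext x
    simp
  rw [nuAlphaE, Measure.map_apply measurable_coe_nnreal_ennreal measurableSet_Ioi, hpre,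
    nuAlpha_Ioi hα hδ]
  exact ENNReal.ofReal_lt_top

theorem coneRestr_subset_coneE {m : ℕ} (hm : 1 ≤ m) : coneRestr m ⊆ coneE m := fun _ hx =>
  hx ⟨0, hm⟩

end FiniteDimensional

end TailChain

end

/-! ### The main theorem -/

open TailChain in
theorem mainTheorem6 {Ω : Type*} [MeasurableSpace Ω] (P : Measure Ω) [IsProbabilityMeasure P]
    (K : Kernel ℝ≥0 ℝ≥0) [IsMarkovKernel K]
    (G H : Measure ℝ≥0) [IsProbabilityMeasure G] [IsProbabilityMeasure H]
    (X : ℕ → Ω → ℝ≥0) (hX : IsMarkovChain X K P) (hX0 : P.map (X 0) = H)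
    (hK : InDomainOfAttraction K G)
    (α : ℝ) (hα : 0 < α) (b : ℝ≥0 → ℝ≥0) (hb : Tendsto b atTop atTop)
    (hH : VagueTendstoOn posCone atTop
      (fun t : ℝ≥0 => t • H.map fun x : ℝ≥0 => ((x / b t : ℝ≥0) : ℝ≥0∞)) (nuAlphaE α))
    (m : ℕ) (hm : 1 ≤ m) :
    -- (a)
    VagueTendstoOn (coneRestr m) atTop (fun t : ℝ≥0 => t • scaledFdd P X m (b t)) (nuStar G α m) ∧
    -- (b)
    (∀ y : ℝ≥0 → ℝ≥0, IsUniformExtremalBoundary K G y →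
      VagueTendstoOn (coneE m) atTop
        (fun t : ℝ≥0 => t • scaledFdd P (extremalComponent X y (b t)) m (b t))
        (nuStar G α m)) ∧
    -- (c)
    (G {0} = 0 ∨ IsExtremalBoundary K G (fun _ => 0) ∨ RegularityCondition K →
      VagueTendstoOn (coneE m) atTop (fun t : ℝ≥0 => t • scaledFdd P X m (b t)) (nuStar G α m)) ∧
    -- (d)
    (∀ y : ℝ≥0 → ℝ≥0, IsUniformExtremalBoundary K G y →
      VagueTendstoOn posCone atTop
        (fun t : ℝ≥0 => t • (P.restrict {ω | (m : ℕ∞) ≤ tau X y (b t) ω}).map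
          fun ω => ((X 0 ω / b t : ℝ≥0) : ℝ≥0∞))
        ((1 - G {0}) ^ (m - 1) • nuAlphaE α)) := by
  subst hX0
  have hfin : ∀ᶠ t : ℝ≥0 in atTop, IsFiniteMeasure (t • scaledFdd P X m (b t)) :=
    Eventually.of_forall fun t => isFiniteMeasure_smul_scaledFdd P X m t (b t)
  -- The case of an isolated `0`, with no restriction on the test functions: shared by (b) and the
  -- first two alternatives of (c).
  have hpure : ∀ {Q : ℝ≥0 → Kernel ℝ≥0 ℝ≥0} [∀ s, IsMarkovKernel (Q s)],
      TailLimit Q G (pure 0) →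
      (∀ m, ∀ f₀ : PathFun (m + 1), Tendsto (pathExpectCons Q m)
        (atTop ×ˢ pure 0 ×ˢ 𝓝[univ] f₀) (𝓝 (f₀ 0 : ℝ≥0∞))) →
      ∀ {f : PathFun (m + 1)} {δ : ℝ≥0}, 0 < δ → (∀ w, w 0 ≤ (δ : ℝ≥0∞) → f w = 0) →
      Tendsto (fun t => t * ∫⁻ x, pathExpectCons Q m (b t, x / b t, f) ∂P.map (X 0)) atTop
        (𝓝 (∫⁻ w, (f w : ℝ≥0∞) ∂nuStar G α m)) := fun hQ hQ0 f δ hδ hfδ =>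
    tendsto_lintegral_pathExpectCons hα hb hH isNhdsSystem_nhdsWithZero_pure hQ
      (S := fun _ => univ) (fun _ _ _ _ => mem_univ _) (fun m f _ => hQ0 m f) (mem_univ f) hδ hfδ
  have hvanish : ∀ {f : PathFun (m + 1)} {A : Set (Fin (m + 1) → ℝ≥0∞)}, A ⊆ coneE m →
      IsCompact A → (∀ x ∉ A, f x = 0) →
      ∃ δ : ℝ≥0, 0 < δ ∧ ∀ w, w 0 ≤ (δ : ℝ≥0∞) → f w = 0 := by
    intro f A hAS hA hfA
    obtain ⟨δ, hδ, hδA⟩ := exists_lt_of_isCompact hA (continuous_apply 0) hAS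
    exact ⟨δ, hδ, fun w hw => hfA w fun h => (hδA w h).not_ge hw⟩
  refine ⟨?_, fun y hy => ?_, fun h => ?_, fun y hy => ?_⟩
  · refine vagueTendstoOn_of_forall_continuousMap (isOpen_coneRestr m) hfin
      (fun A hAS hA => nuStar_lt_top G hα (hAS.trans (coneRestr_subset_coneE hm)) hA)
      fun f A hAS hA hfA => ?_
    have hδ : ∀ i : Fin m, ∃ δ : ℝ≥0, 0 < δ ∧ ∀ x ∈ A, (δ : ℝ≥0∞) < x i.castSucc := fun i =>
      exists_lt_of_isCompact hA (continuous_apply i.castSucc) fun _ hx => hAS hx i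
    choose ε hε hεA using hδ
    have hne : (Finset.univ : Finset (Fin m)).Nonempty := ⟨⟨0, hm⟩, Finset.mem_univ _⟩
    -- One threshold for all coordinates but the last; the minimum exists because `m ≥ 1`.
    set δ := Finset.univ.inf' hne ε with hδ_def
    have hδ : 0 < δ := (Finset.lt_inf'_iff hne).2 fun i _ => hε i
    have hδf : ∀ (i : Fin m) (w : Fin (m + 1) → ℝ≥0∞), w i.castSucc ≤ δ → f w = 0 := by
      refine fun i w hw => hfA w fun h => (hεA i w h).not_ge (hw.trans ?_)
      exact ENNReal.coe_le_coe.2 (Finset.inf'_le _ (Finset.mem_univ i))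
    have hfS : f ∈ vanishingPathFun δ (m + 1) := by
      intro w i hi hw
      exact hδf ⟨i, by omega⟩ w hw
    refine hX.tendsto_lintegral_scaledFdd hb (tendsto_lintegral_pathExpectCons hα hb hH
      (Z := 𝓝 0) ?_ hK.tailLimit_nhds (fun _ _ hf x => tail_mem_vanishingPathFun hf x)
      (fun _ _ hf => tendsto_pathExpectCons_vanishingPathFun _ hδ hf) hfS hδ (hδf ⟨0, hm⟩))
    rw [nhdsWithZero_nhds]
    exact isNhdsSystem_nhds
  · refine vagueTendstoOn_of_forall_continuousMap (isOpen_coneE m)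
      (Eventually.of_forall fun t => isFiniteMeasure_smul_scaledFdd P _ m t (b t))
      (fun _ hAS hA => nuStar_lt_top G hα hAS hA) fun f A hAS hA hfA => ?_
    obtain ⟨δ, hδ, hfδ⟩ := hvanish hAS hA hfA
    exact hX.tendsto_lintegral_scaledFdd_extremalComponent hb hy.tendsto_zero hδ hfδ
      (hpure (hy.tailLimit_killedKernel hK) (fun m f =>
        tendsto_pathExpectCons_pure_of_absorbing (fun s => killedKernel_zero _ _) univ f) hδ hfδ)
  · refine vagueTendstoOn_of_forall_continuousMap (isOpen_coneE m) hfin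
      (fun _ hAS hA => nuStar_lt_top G hα hAS hA) fun f A hAS hA hfA => ?_
    obtain ⟨δ, hδ, hfδ⟩ := hvanish hAS hA hfA
    refine hX.tendsto_lintegral_scaledFdd hb ?_
    rcases h with h | h | h
    -- Without an atom at `0`, the lower bound required there is trivial.
    · refine hpure (hK.tailLimit_pure fun _ _ => ?_)
        (fun m f => tendsto_pathExpectCons_pure_scaledKernel K univ f) hδ hfδ
      rw [h]
      exact bot_le
    · exact hpure (hK.tailLimit_pure fun x₀ hx₀ => h.le_liminf_scaledKernel_zero hx₀)
        (fun m f => tendsto_pathExpectCons_pure_scaledKernel K univ f) hδ hfδ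
    · refine tendsto_lintegral_pathExpectCons hα hb hH (Z := 𝓝 0) ?_ hK.tailLimit_nhds
        (S := fun _ => univ) (fun _ _ _ _ => mem_univ _)
        (fun m f _ => tendsto_pathExpectCons_of_regularityCondition h f) (mem_univ f) hδ hfδ
      rw [nhdsWithZero_nhds]
      exact isNhdsSystem_nhds
  -- The test functions already force the start above the boundary, so `τ ≥ k + 1` costs only `k`
  -- survival steps; hence the exponent `m - 1`.
  · obtain ⟨k, rfl⟩ : ∃ k, m = k + 1 := ⟨m - 1, by omega⟩
    have hc : (1 - G {0}) ^ k ≤ 1 := pow_le_one₀ bot_le tsub_le_self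
    refine vagueTendstoOn_of_forall_continuousMap (S := posCone) isOpen_Ioi
      (Eventually.of_forall fun t => inferInstance) (fun A hAS hA => ?_) fun f A hAS hA hfA => ?_
    · rw [Measure.smul_apply, smul_eq_mul]
      exact ENNReal.mul_lt_top (hc.trans_lt ENNReal.one_lt_top) (nuAlphaE_lt_top hα hAS hA)
    · obtain ⟨δ, hδ, hδA⟩ := exists_lt_of_isCompact hA continuous_id hAS
      exact hX.tendsto_lintegral_survival hα hb hH hK hy k hδ
        fun x hx => hfA x fun h => (hδA x h).not_ge hx
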